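/- **Setting.** Let $\mathbb F$ be a field complete with respect to a non-trivial non-archimedean absolute value $|\cdot|$, let $t\in\mathbb F$ with $0<|t|<1$, and let $\mathcal O=\{x\in\mathbb F: |x|\le 1\}$ be its valuation ring. *The algebra.* $\mathcal H_\infty$ is the unital associative $\mathbb F$-algebra generated by $T_1,T_2,\dots$ with relations $(T_i-1)(T_i+t)=0$, $T_iT_{i+1}T_i=T_{i+1}T_iT_{i+1}$, and $T_iT_j=T_jT_i$ for $|i-j|>1$. For a permutation $\sigma$ of $\{1,2,\dots\}$ that moves only finitely many points and a reduced expression $\sigma=s_{i_1}\cdots s_{i_r}$ in the simple transpositions $s_i=(i\;\,i+1)$, put $T_\sigma=T_{i_1}\cdots T_{i_r}$; the $T_\sigma$ form the standard basis of $\mathcal H_\infty$. *The representation.* For a partition $\lambda$ let $\lambda^{(\infty)}$ be the diagram with an infinite first row on top of the rows of $\lambda$ (left-adjusted, row index increasing downwards). A box in row $i$ and column $j$ has content $c=j-i$. Let $\mathrm{SYT}_\infty(\lambda)$ be the set of bijections $\tau:\lambda^{(\infty)}\to\{1,2,\dots\}$ that increase strictly along rows from left to right and down columns. Write $c_\tau(i)$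 for the content of the box of $\tau$ labelled $i$, and $s_i(\tau)$ for the result of swapping the labels $i,i+1$. If $s_i(\tau)$ is standard, write $s_i(\tau)>\tau$ if $i+1$ lies strictly to the right of and strictly above $i$ in $\tau$, and $s_i(\tau)<\tau$ if $i$ lies strictly to the right of and strictly above $i+1$ in $\tau$. Let $\hat S_\lambda=c_0(\mathrm{SYT}_\infty(\lambda))$ be the Banach space of formal sums $\sum_\tau \alpha_\tau e_\tau$ with $\alpha_\tau\to0$, with the supremum norm. $\mathcal H_\infty$ acts on $\hat S_\lambda$ by the bounded operators given by $T_i(\sum_\tau\alpha_\tau e_\tau)=\sum_\tau\alpha_\tau T_i(e_\tau)$ and - $T_i(e_\tau)=e_{s_i(\tau)}+\dfrac{1-t}{1-t^{c_\tau(i+1)-c_\tau(i)}}\,e_\tau$ if $s_i(\tau)>\tau$; - $T_i(e_\tau)=t\,\dfrac{(1-t^{d-1})(1-t^{d+1})}{(1-t^{d})^2}\,e_{s_i(\tau)}-t^{d}\,\dfrac{1-t}{1-t^{d}}\,e_\tau$ with $d=c_\tau(i)-c_\tau(i+1)$, if $s_i(\tau)<\tau$; - $T_i(e_\tau)=e_\tau$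 if $i,i+1$ are in the same row of $\tau$, and $T_i(e_\tau)=-t\,e_\tau$ if they are in the same column. *The inner product and the renormalized basis.* Let $\tau_\lambda\in \mathrm{SYT}_\infty(\lambda)$ be the tableau obtained by numbering the boxes column by column from left to right, each column from top to bottom. Let $\mathrm{Inv}(\tau)$ be the (finite) set of pairs of boxes $(\square_1,\square_2)$ with $\tau_\lambda(\square_1)<\tau_\lambda(\square_2)$ and $\tau(\square_1)>\tau(\square_2)$. Put $$a(\tau)=\prod_{(\square_1,\square_2)\in\mathrm{Inv}(\tau)} t\,\frac{(1-t^{c(\square_2)-c(\square_1)-1})(1-t^{c(\square_2)-c(\square_1)+1})}{(1-t^{c(\square_2)-c(\square_1)})^2},\qquad \Big(\sum_\tau\alpha_\tau e_\tau,\sum_\tau\beta_\tau e_\tau\Big)_\lambda=\sum_\tau\alpha_\tau\beta_\tau\,a(\tau).$$ This is a continuous non-degenerate symmetric bilinear form on $\hat S_\lambda$ for which every $T_i$ is self-adjoint and $(e_{\tau_\lambda},e_{\tau_\lambda})_\lambda=1$. Put $$\tilde e_\tau=\prod_{(\square_1,\square_2)\in\mathrm{Inv}(\tau)}\frac{1-t^{c(\square_2)-c(\square_1)}}{1-t^{c(\square_2)-c(\square_1)+1}}\;e_\tau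 .$$ **Theorem.** Let $\lambda$ be a partition. 1. For every bounded operator $A$ on $\hat S_\lambda$ the series $\sum_{\tau\in\mathrm{SYT}_\infty(\lambda)}(A\tilde e_\tau,\tilde e_\tau)_\lambda$ converges in $\mathbb F$ (unconditionally). In particular the regularized trace $\Gamma_\lambda(X)=\sum_{\tau\in\mathrm{SYT}_\infty(\lambda)}(X\tilde e_\tau,\tilde e_\tau)_\lambda$ is defined for every $X\in\mathcal H_\infty$. 2. For every $X$ in the $\mathcal O$-span of $\{T_\sigma\}$ in $\mathcal H_\infty$, $\Gamma_\lambda(X)\in\mathcal O$. -/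

import Mathlib

open scoped ZeroAtInfty

namespace InfHecke

/-! ### The infinite Young diagram and its standard tableaux -/

section Combinatorics

/-- The infinite diagram `λ^(∞)`: an infinite row (row `0`) stacked on top of the rows of `λ`.
Boxes are pairs `(row, column)`, both counted from `0`. -/
def infDiagram (lam : YoungDiagram) : Set (ℕ × ℕ) :=
  {p | p.1 = 0 ∨ (p.1 - 1, p.2) ∈ lam}

/-- The boxes of `λ^(∞)`. -/
abbrev Box (lam : YoungDiagram) : Type := {p : ℕ × ℕ // p ∈ infDiagram lam}

/-- The row of a box. -/
def Box.row {lam : YoungDiagram} (p : Box lam) : ℕ := p.1.1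

/-- The column of a box. -/
def Box.col {lam : YoungDiagram} (p : Box lam) : ℕ := p.1.2

/-- The content of a box: column minus row. -/
def Box.content {lam : YoungDiagram} (p : Box lam) : ℤ := (p.col : ℤ) - (p.row : ℤ)

/-- A bijective filling of `λ^(∞)` by the labels `0, 1, 2, …` is standard if it increases strictly
along rows (left to right) and along columns (top to bottom). -/
structure IsStandard {lam : YoungDiagram} (τ : Box lam ≃ ℕ) : Prop where
  row_lt : ∀ p q : Box lam, p.row = q.row → p.col < q.col → τ p < τ q
  col_lt : ∀ p q : Box lam, p.col = q.col → p.row < q.row → τ p < τ q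

/-- The set `SYT_∞(λ)` of standard fillings of `λ^(∞)`; the labels are `0, 1, 2, …`
(so label `i` here is label `i + 1` when labels are counted from `1`). -/
abbrev InfSYT (lam : YoungDiagram) : Type := {τ : Box lam ≃ ℕ // IsStandard τ}

/-- `SYT_∞(λ)` is a discrete set. -/
instance (lam : YoungDiagram) : TopologicalSpace (InfSYT lam) := ⊥

instance (lam : YoungDiagram) : DiscreteTopology (InfSYT lam) := ⟨rfl⟩

variable {lam : YoungDiagram}

/-- The box of `τ` with label `i`. -/
def pos (τ : InfSYT lam) (i : ℕ) : Box lam := τ.1.symm i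

/-- The content `c_τ(i)` of the box of `τ` with label `i`. -/
def cont (τ : InfSYT lam) (i : ℕ) : ℤ := (pos τ i).content

/-- The filling obtained by swapping the labels `i` and `i + 1`. -/
def swapFilling (i : ℕ) (τ : InfSYT lam) : Box lam ≃ ℕ := τ.1.trans (Equiv.swap i (i + 1))

open Classical in
/-- `s_i(τ)`: swap the labels `i` and `i + 1` if the result is standard (and `τ` itself, a value
that is never used, otherwise). -/
noncomputable def simpleSwap (i : ℕ) (τ : InfSYT lam) : InfSYT lam :=
  if h : IsStandard (swapFilling i τ) then ⟨swapFilling i τ, h⟩ else τ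

/-- `s_i(τ) > τ`: swapping the labels `i` and `i + 1` gives a standard filling, and `i + 1` lies
strictly to the right of and strictly above `i` in `τ`. -/
def Ascends (i : ℕ) (τ : InfSYT lam) : Prop :=
  IsStandard (swapFilling i τ) ∧
    (pos τ i).col < (pos τ (i + 1)).col ∧ (pos τ (i + 1)).row < (pos τ i).row

/-- `s_i(τ) < τ`: swapping the labels `i` and `i + 1` gives a standard filling, and `i` lies
strictly to the right of and strictly above `i + 1` in `τ`. -/
def Descends (i : ℕ) (τ : InfSYT lam) : Prop :=
  IsStandard (swapFilling i τ) ∧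
    (pos τ (i + 1)).col < (pos τ i).col ∧ (pos τ i).row < (pos τ (i + 1)).row

/-- The labels `i` and `i + 1` are in the same row of `τ`. -/
def SameRow (i : ℕ) (τ : InfSYT lam) : Prop := (pos τ i).row = (pos τ (i + 1)).row

lemma mem_infDiagram_of_le {p q : ℕ × ℕ} (hq : q ∈ infDiagram lam) (h1 : p.1 ≤ q.1)
    (h2 : p.2 ≤ q.2) : p ∈ infDiagram lam := by
  rcases Nat.eq_zero_or_pos p.1 with h | h
  · exact Or.inl h
  · rcases hq with hq | hq
    · omega
    · exact Or.inr (lam.up_left_mem (by omega) h2 hq)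

lemma box_ext {p q : Box lam} (h1 : p.row = q.row) (h2 : p.col = q.col) : p = q :=
  Subtype.ext (Prod.ext h1 h2)

lemma IsStandard.lt_of_le {τ : Box lam ≃ ℕ} (hτ : IsStandard τ) {p q : Box lam}
    (h1 : p.row ≤ q.row) (h2 : p.col ≤ q.col) (hne : p ≠ q) : τ p < τ q := by
  have hm : (p.row, q.col) ∈ infDiagram lam := mem_infDiagram_of_le q.2 h1 le_rfl
  let m : Box lam := ⟨(p.row, q.col), hm⟩
  have hpm : τ p ≤ τ m := by
    rcases h2.lt_or_eq with h | h
    · exact (hτ.row_lt p m rfl h).le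
    · rw [show p = m from box_ext rfl h]
  have hmq : τ m ≤ τ q := by
    rcases h1.lt_or_eq with h | h
    · exact (hτ.col_lt m q rfl h).le
    · rw [show m = q from box_ext h rfl]
  exact lt_of_le_of_ne (hpm.trans hmq) fun h => hne (τ.injective h)

lemma IsStandard.add_three_le {τ : Box lam ≃ ℕ} (hτ : IsStandard τ) {p q : Box lam}
    (h1 : p.row < q.row) (h2 : p.col < q.col) : τ p + 3 ≤ τ q := by
  let u : Box lam := ⟨(p.row, p.col + 1), mem_infDiagram_of_le q.2 h1.le h2⟩
  let v : Box lam := ⟨(p.row + 1, p.col), mem_infDiagram_of_le q.2 h1 h2.le⟩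
  have hu1 : u.row = p.row := rfl
  have hu2 : u.col = p.col + 1 := rfl
  have hv1 : v.row = p.row + 1 := rfl
  have hv2 : v.col = p.col := rfl
  have hne : ∀ {a b : Box lam}, a.row ≠ b.row → a ≠ b := fun h e => h (by rw [e])
  have hne' : ∀ {a b : Box lam}, a.col ≠ b.col → a ≠ b := fun h e => h (by rw [e])
  have h3 := hτ.lt_of_le (p := p) (q := u) (by omega) (by omega) (hne' (by omega))
  have h4 := hτ.lt_of_le (p := p) (q := v) (by omega) (by omega) (hne (by omega))
  have h5 := hτ.lt_of_le (p := u) (q := q) (by omega) (by omega) (hne (by omega))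
  have h6 := hτ.lt_of_le (p := v) (q := q) (by omega) (by omega) (hne' (by omega))
  have h7 : τ u ≠ τ v := fun h => hne (by omega) (τ.injective h)
  omega

@[simp] lemma apply_pos (τ : InfSYT lam) (i : ℕ) : τ.1 (pos τ i) = i := τ.1.apply_symm_apply i

/-- Two labels that differ by one or two: the box of the larger one lies strictly to the right and
weakly above, or strictly below and weakly to the left. -/
lemma pos_cases (τ : InfSYT lam) {i j : ℕ} (h1 : i < j) (h2 : j ≤ i + 2) :
    ((pos τ i).col < (pos τ j).col ∧ (pos τ j).row ≤ (pos τ i).row) ∨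
      ((pos τ i).row < (pos τ j).row ∧ (pos τ j).col ≤ (pos τ i).col) := by
  by_contra hcon
  by_cases h : (pos τ i).row < (pos τ j).row ∧ (pos τ i).col < (pos τ j).col
  · have := τ.2.add_three_le h.1 h.2
    simp only [apply_pos] at this
    omega
  · have hne : pos τ j ≠ pos τ i := fun e => by
      have := congrArg τ.1 e
      simp only [apply_pos] at this
      omega
    have := τ.2.lt_of_le (p := pos τ j) (q := pos τ i) (by omega) (by omega) hne
    simp only [apply_pos] at this
    omega

lemma cont_ne (τ : InfSYT lam) {i j : ℕ} (h1 : i < j) (h2 : j ≤ i + 2) : cont τ i ≠ cont τ j := by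
  have := pos_cases τ h1 h2
  simp only [cont, Box.content]
  omega

/-- Consecutive labels: same row, same column, or diagonal positions at content distance at
least two. -/
lemma pos_succ_cases (τ : InfSYT lam) (i : ℕ) :
    ((pos τ i).row = (pos τ (i + 1)).row ∧ cont τ (i + 1) - cont τ i = 1) ∨
    ((pos τ i).col = (pos τ (i + 1)).col ∧ cont τ (i + 1) - cont τ i = -1) ∨
    ((pos τ i).col < (pos τ (i + 1)).col ∧ (pos τ (i + 1)).row < (pos τ i).row) ∨
    ((pos τ (i + 1)).col < (pos τ i).col ∧ (pos τ i).row < (pos τ (i + 1)).row) := by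
  have hc := pos_cases τ (Nat.lt_succ_self i) (by omega)
  set p := pos τ i with hp
  set q := pos τ (i + 1) with hq
  have hpi : τ.1 p = i := apply_pos τ i
  have hqi : τ.1 q = i + 1 := apply_pos τ (i + 1)
  have hcp : cont τ i = (p.col : ℤ) - p.row := rfl
  have hcq : cont τ (i + 1) = (q.col : ℤ) - q.row := rfl
  rw [hcp, hcq]
  rcases hc with ⟨h1, h2⟩ | ⟨h1, h2⟩
  · rcases h2.lt_or_eq with h | h
    · exact Or.inr (Or.inr (Or.inl ⟨h1, h⟩))
    · refine Or.inl ⟨h.symm, ?_⟩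
      by_contra hne
      let u : Box lam := ⟨(p.row, p.col + 1), mem_infDiagram_of_le q.2 h.ge h1⟩
      have hlt : p.col + 1 < q.col := by omega
      have h3 := τ.2.row_lt p u rfl (Nat.lt_succ_self _)
      have h4 := τ.2.row_lt u q h.symm hlt
      omega
  · rcases h2.lt_or_eq with h | h
    · exact Or.inr (Or.inr (Or.inr ⟨h, h1⟩))
    · refine Or.inr (Or.inl ⟨h.symm, ?_⟩)
      by_contra hne
      let u : Box lam := ⟨(p.row + 1, p.col), mem_infDiagram_of_le q.2 h1 h.ge⟩
      have hlt : p.row + 1 < q.row := by omega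
      have h3 := τ.2.col_lt p u rfl (Nat.lt_succ_self _)
      have h4 := τ.2.col_lt u q h.symm hlt
      omega

lemma isStandard_swapFilling (τ : InfSYT lam) (i : ℕ)
    (h1 : (pos τ i).row ≠ (pos τ (i + 1)).row) (h2 : (pos τ i).col ≠ (pos τ (i + 1)).col) :
    IsStandard (swapFilling i τ) := by
  have key : ∀ p q : Box lam, (p.row = q.row ∨ p.col = q.col) → τ.1 p < τ.1 q →
      swapFilling i τ p < swapFilling i τ q := by
    intro p q hpq hlt
    have hn : ¬ (τ.1 p = i ∧ τ.1 q = i + 1) := by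
      rintro ⟨e1, e2⟩
      have e1' : p = pos τ i := by rw [← e1]; exact (τ.1.symm_apply_apply p).symm
      have e2' : q = pos τ (i + 1) := by rw [← e2]; exact (τ.1.symm_apply_apply q).symm
      rw [e1', e2'] at hpq
      exact hpq.elim h1 h2
    simp only [swapFilling, Equiv.trans_apply, Equiv.swap_apply_def]
    split_ifs <;> omega
  exact ⟨fun p q h h' => key p q (Or.inl h) (τ.2.row_lt p q h h'),
    fun p q h h' => key p q (Or.inr h) (τ.2.col_lt p q h h')⟩

lemma simpleSwap_val {i : ℕ} {τ : InfSYT lam} (h : IsStandard (swapFilling i τ)) :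
    (simpleSwap i τ).1 = swapFilling i τ := by
  rw [simpleSwap, dif_pos h]

lemma pos_simpleSwap {i : ℕ} {τ : InfSYT lam} (h : IsStandard (swapFilling i τ)) (j : ℕ) :
    pos (simpleSwap i τ) j = pos τ (Equiv.swap i (i + 1) j) := by
  simp [pos, simpleSwap_val h, swapFilling]

lemma cont_simpleSwap {i : ℕ} {τ : InfSYT lam} (h : IsStandard (swapFilling i τ)) (j : ℕ) :
    cont (simpleSwap i τ) j = cont τ (Equiv.swap i (i + 1) j) := by
  simp [cont, pos_simpleSwap h]

/-- The content gap `c_τ(i + 1) - c_τ(i)`. -/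
def gap (τ : InfSYT lam) (i : ℕ) : ℤ := cont τ (i + 1) - cont τ i

lemma ascends_iff (τ : InfSYT lam) (i : ℕ) : Ascends i τ ↔ 2 ≤ gap τ i := by
  have h := pos_succ_cases τ i
  unfold Ascends gap
  constructor
  · rintro ⟨-, h1, h2⟩
    simp only [cont, Box.content]
    omega
  · intro h2
    have h3 : (pos τ i).col < (pos τ (i + 1)).col ∧ (pos τ (i + 1)).row < (pos τ i).row := by
      simp only [cont, Box.content] at h h2
      omega
    exact ⟨isStandard_swapFilling τ i (by omega) (by omega), h3⟩

lemma descends_iff (τ : InfSYT lam) (i : ℕ) : Descends i τ ↔ gap τ i ≤ -2 := by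
  have h := pos_succ_cases τ i
  unfold Descends gap
  constructor
  · rintro ⟨-, h1, h2⟩
    simp only [cont, Box.content]
    omega
  · intro h2
    have h3 : (pos τ (i + 1)).col < (pos τ i).col ∧ (pos τ i).row < (pos τ (i + 1)).row := by
      simp only [cont, Box.content] at h h2
      omega
    exact ⟨isStandard_swapFilling τ i (by omega) (by omega), h3⟩

lemma gap_cases (τ : InfSYT lam) (i : ℕ) :
    (gap τ i = 1 ∧ SameRow i τ) ∨ (gap τ i = -1 ∧ ¬ SameRow i τ) ∨ 2 ≤ gap τ i ∨ gap τ i ≤ -2 := by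
  have h := pos_succ_cases τ i
  unfold SameRow gap
  simp only [cont, Box.content] at *
  omega

lemma isStandard_of_gap {τ : InfSYT lam} {i : ℕ} (h : 2 ≤ gap τ i ∨ gap τ i ≤ -2) :
    IsStandard (swapFilling i τ) :=
  h.elim (fun h => ((ascends_iff τ i).2 h).1) fun h => ((descends_iff τ i).2 h).1

end Combinatorics
/-! ### The Banach space `c₀(S)` -/

section CZero

variable {𝔽 : Type*} [NontriviallyNormedField 𝔽] {S : Type*} [TopologicalSpace S]

lemma norm_apply_le (f : C₀(S, 𝔽)) (x : S) : ‖f x‖ ≤ ‖f‖ :=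
  f.toBCF.norm_coe_le_norm x

lemma norm_le_of_forall {f : C₀(S, 𝔽)} {C : ℝ} (hC : 0 ≤ C) (h : ∀ x, ‖f x‖ ≤ C) : ‖f‖ ≤ C :=
  (BoundedContinuousFunction.norm_le (f := f.toBCF) hC).2 h

variable [DiscreteTopology S]

open Classical in
/-- The standard basis vector `e_s` of `c₀(S)`, the indicator function of `s`. -/
noncomputable def basisVec (s : S) : C₀(S, 𝔽) where
  toFun := Pi.single (M := fun _ => 𝔽) s 1
  continuous_toFun := continuous_of_discreteTopology
  zero_at_infty' := by
    rw [Filter.cocompact_eq_cofinite]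
    refine tendsto_const_nhds.congr' ?_
    have : ({s}ᶜ : Set S) ∈ Filter.cofinite := (Set.finite_singleton s).compl_mem_cofinite
    filter_upwards [this] with x hx
    exact (Pi.single_eq_of_ne (M := fun _ => 𝔽) hx 1).symm

lemma basisVec_self (s : S) : (basisVec s : C₀(S, 𝔽)) s = 1 := by
  classical exact Pi.single_eq_same (M := fun _ => 𝔽) s 1

lemma basisVec_ne {s x : S} (h : x ≠ s) : (basisVec s : C₀(S, 𝔽)) x = 0 := by
  classical exact Pi.single_eq_of_ne (M := fun _ => 𝔽) h 1

lemma norm_basisVec_le (s : S) : ‖(basisVec s : C₀(S, 𝔽))‖ ≤ 1 := by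
  refine norm_le_of_forall zero_le_one fun x => ?_
  by_cases h : x = s
  · rw [h, basisVec_self, norm_one]
  · rw [basisVec_ne h, norm_zero]; exact zero_le_one

lemma tendsto_cofinite (f : C₀(S, 𝔽)) : Filter.Tendsto f Filter.cofinite (nhds 0) := by
  have := f.zero_at_infty'
  rwa [Filter.cocompact_eq_cofinite] at this

instance [IsUltrametricDist 𝔽] : IsUltrametricDist C₀(S, 𝔽) :=
  IsUltrametricDist.isUltrametricDist_of_forall_norm_add_le_max_norm fun f g =>
    norm_le_of_forall (le_max_of_le_left (norm_nonneg f)) fun x =>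
      (IsUltrametricDist.norm_add_le_max (f x) (g x)).trans
        (max_le_max (norm_apply_le f x) (norm_apply_le g x))

variable [CompleteSpace 𝔽] [IsUltrametricDist 𝔽]

lemma summable_smul (v : S → C₀(S, 𝔽)) (C : ℝ) (hv : ∀ s, ‖v s‖ ≤ C) (f : C₀(S, 𝔽)) :
    Summable fun s => f s • v s := by
  refine NonarchimedeanAddGroup.summable_of_tendsto_cofinite_zero ?_
  have h := (tendsto_cofinite f).norm.mul_const C
  rw [norm_zero, zero_mul] at h
  refine squeeze_zero_norm (fun s => ?_) h
  rw [norm_smul]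
  exact mul_le_mul_of_nonneg_left (hv s) (norm_nonneg _)

/-- The bounded operator on `c₀(S)` with prescribed (uniformly bounded) values `v s` on the basis
vectors `e_s`: it sends `∑ f(s) e_s` to `∑ f(s) v(s)`. -/
noncomputable def extendBasis (v : S → C₀(S, 𝔽)) (C : ℝ) (hv : ∀ s, ‖v s‖ ≤ C) :
    C₀(S, 𝔽) →L[𝔽] C₀(S, 𝔽) :=
  LinearMap.mkContinuous
    { toFun := fun f => ∑' s, f s • v s
      map_add' := fun f g => by
        rw [← (summable_smul v C hv f).tsum_add (summable_smul v C hv g)]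
        exact tsum_congr fun s => by rw [ZeroAtInftyContinuousMap.add_apply]; exact add_smul (f s) (g s) (v s)
      map_smul' := fun c f => by
        rw [RingHom.id_apply, ← (summable_smul v C hv f).tsum_const_smul c]
        exact tsum_congr fun s => by
          rw [ZeroAtInftyContinuousMap.smul_apply, smul_assoc] }
    (max C 0) fun f => by
      rcases isEmpty_or_nonempty S with hS | hS
      · simp only [LinearMap.coe_mk, AddHom.coe_mk, tsum_empty, norm_zero]
        positivity
      · refine IsUltrametricDist.norm_tsum_le_of_forall_le fun s => ?_
        rw [norm_smul, mul_comm]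
        exact mul_le_mul ((hv s).trans (le_max_left _ _)) (norm_apply_le f s) (norm_nonneg _)
          (le_max_right _ _)

lemma extendBasis_apply (v : S → C₀(S, 𝔽)) (C : ℝ) (hv : ∀ s, ‖v s‖ ≤ C) (f : C₀(S, 𝔽)) :
    extendBasis v C hv f = ∑' s, f s • v s := rfl

lemma extendBasis_basisVec (v : S → C₀(S, 𝔽)) (C : ℝ) (hv : ∀ s, ‖v s‖ ≤ C) (s : S) :
    extendBasis v C hv (basisVec s) = v s := by
  rw [extendBasis_apply, tsum_eq_single s, basisVec_self, one_smul]
  intro x hx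
  rw [basisVec_ne hx, zero_smul]

lemma tsum_basisVec (f : C₀(S, 𝔽)) : ∑' s, f s • (basisVec s : C₀(S, 𝔽)) = f := by
  have hs := summable_smul (𝔽 := 𝔽) basisVec 1 norm_basisVec_le f
  ext x
  let ev : C₀(S, 𝔽) →L[𝔽] 𝔽 := LinearMap.mkContinuous
    { toFun := fun g => g x, map_add' := fun _ _ => rfl, map_smul' := fun _ _ => rfl } 1
    fun g => by rw [one_mul]; exact norm_apply_le g x
  have h : ev (∑' s, f s • (basisVec s : C₀(S, 𝔽))) = ∑' s, ev (f s • basisVec s) := ev.map_tsum hs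
  have h2 : ∀ s, ev (f s • (basisVec s : C₀(S, 𝔽))) = f s * (basisVec s : C₀(S, 𝔽)) x :=
    fun s => rfl
  change ev _ = _
  rw [h, tsum_eq_single x, h2, basisVec_self, mul_one]
  intro s hs
  rw [h2, basisVec_ne hs.symm, mul_zero]

/-- Two bounded operators on `c₀(S)` that agree on the basis vectors are equal. -/
lemma ext_basisVec {A B : C₀(S, 𝔽) →L[𝔽] C₀(S, 𝔽)}
    (h : ∀ s, A (basisVec s) = B (basisVec s)) : A = B := by
  ext1 f
  have hs := summable_smul (𝔽 := 𝔽) basisVec 1 norm_basisVec_le f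
  rw [← tsum_basisVec f, A.map_tsum hs, B.map_tsum hs]
  exact tsum_congr fun s => by rw [map_smul, map_smul, h]

end CZero

/-! ### The infinite Hecke algebra -/

section Hecke

variable {𝔽 : Type*} [NontriviallyNormedField 𝔽]

/-- A pseudo-uniformizer: `0 < |t| < 1`. -/
def IsPseudoUniformizer (t : 𝔽) : Prop := 0 < ‖t‖ ∧ ‖t‖ < 1

/-- The defining relations of the infinite Hecke algebra on generators `T_0, T_1, T_2, …`. -/
inductive HeckeRel (t : 𝔽) : FreeAlgebra 𝔽 ℕ → FreeAlgebra 𝔽 ℕ → Prop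
  | quadratic (i : ℕ) :
      HeckeRel t ((FreeAlgebra.ι 𝔽 i - 1) * (FreeAlgebra.ι 𝔽 i + algebraMap 𝔽 _ t)) 0
  | braid (i : ℕ) :
      HeckeRel t (FreeAlgebra.ι 𝔽 i * FreeAlgebra.ι 𝔽 (i + 1) * FreeAlgebra.ι 𝔽 i)
        (FreeAlgebra.ι 𝔽 (i + 1) * FreeAlgebra.ι 𝔽 i * FreeAlgebra.ι 𝔽 (i + 1))
  | comm (i j : ℕ) (h : i + 1 < j) :
      HeckeRel t (FreeAlgebra.ι 𝔽 i * FreeAlgebra.ι 𝔽 j) (FreeAlgebra.ι 𝔽 j * FreeAlgebra.ι 𝔽 i)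

/-- The infinite Hecke algebra `H_∞`. -/
abbrev HeckeAlgebra (t : 𝔽) : Type _ := RingQuot (HeckeRel t)

/-- The generator `T_i` of `H_∞`. It corresponds to the transposition of the labels `i` and
`i + 1`. -/
noncomputable def heckeGen (t : 𝔽) (i : ℕ) : HeckeAlgebra t :=
  RingQuot.mkAlgHom 𝔽 (HeckeRel t) (FreeAlgebra.ι 𝔽 i)

/-- The permutation `s_{i_1} ⋯ s_{i_r}` of `ℕ` given by a word `i_1 … i_r` in the simple
transpositions. -/
def wordPerm (w : List ℕ) : Equiv.Perm ℕ := (w.map fun i => Equiv.swap i (i + 1)).prod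

/-- The word `w` is a reduced expression of the permutation `σ`. -/
def IsReducedExpr (w : List ℕ) (σ : Equiv.Perm ℕ) : Prop :=
  wordPerm w = σ ∧ ∀ w' : List ℕ, wordPerm w' = σ → w.length ≤ w'.length

/-- The standard basis `{T_σ}` of `H_∞`, where `σ` runs over the permutations of `ℕ` that move
finitely many points and `T_σ = T_{i_1} ⋯ T_{i_r}` for a reduced expression
`σ = s_{i_1} ⋯ s_{i_r}`. -/
def standardBasis (t : 𝔽) : Set (HeckeAlgebra t) :=
  {x | ∃ σ : Equiv.Perm ℕ, {n | σ n ≠ n}.Finite ∧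
    ∃ w : List ℕ, IsReducedExpr w σ ∧ x = (w.map (heckeGen t)).prod}

/-- The valuation ring `𝒪 = {x | |x| ≤ 1}` of `𝔽`. -/
noncomputable abbrev valRing (𝔽 : Type*) [NontriviallyNormedField 𝔽] [IsUltrametricDist 𝔽] : Subring 𝔽 :=
  (NormedField.valuation (K := 𝔽)).integer

/-- The `𝒪`-span of the standard basis of `H_∞`. -/
noncomputable def integralHecke [IsUltrametricDist 𝔽] (t : 𝔽) :
    Submodule (valRing 𝔽) (HeckeAlgebra t) :=
  Submodule.span (valRing 𝔽) (standardBasis t)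

end Hecke

/-! ### The representation of `H_∞` on `Ŝ_λ` -/

section Specht

variable {𝔽 : Type*} [NontriviallyNormedField 𝔽] {lam : YoungDiagram}

/-- The Banach space `Ŝ_λ = c₀(SYT_∞(λ))` with the supremum norm. -/
abbrev SpechtHat (𝔽 : Type*) [NontriviallyNormedField 𝔽] (lam : YoungDiagram) : Type _ :=
  C₀(InfSYT lam, 𝔽)

open Classical in
/-- The vector `T_i(e_τ)`. The last case is the one where `i` and `i + 1` are in the same column
of `τ`. -/
noncomputable def heckeOnBasis (t : 𝔽) (i : ℕ) (τ : InfSYT lam) : SpechtHat 𝔽 lam :=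
  if Ascends i τ then
    basisVec (simpleSwap i τ) +
      ((1 - t) / (1 - t ^ (cont τ (i + 1) - cont τ i))) • basisVec τ
  else if Descends i τ then
    (t * ((1 - t ^ (cont τ i - cont τ (i + 1) - 1)) * (1 - t ^ (cont τ i - cont τ (i + 1) + 1))) /
      (1 - t ^ (cont τ i - cont τ (i + 1))) ^ 2) • basisVec (simpleSwap i τ) -
      (t ^ (cont τ i - cont τ (i + 1)) * ((1 - t) / (1 - t ^ (cont τ i - cont τ (i + 1))))) •
        basisVec τ
  else if SameRow i τ then basisVec τ
  else (-t) • basisVec τ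

/-- The coefficient of `e_τ` in `T_i(e_τ)`, as a function of the content gap. -/
noncomputable def diagCoef (t : 𝔽) (d : ℤ) : 𝔽 := (1 - t) / (1 - t ^ d)

/-- The coefficient of `e_{s_i(τ)}` in `T_i(e_τ)`, as a function of the content gap. -/
noncomputable def swapCoef (t : 𝔽) (d : ℤ) : 𝔽 :=
  if 2 ≤ d then 1
  else if d ≤ -2 then t * ((1 - t ^ (-d - 1)) * (1 - t ^ (-d + 1))) / (1 - t ^ (-d)) ^ 2
  else 0

lemma IsPseudoUniformizer.ne_zero {t : 𝔽} (ht : IsPseudoUniformizer t) : t ≠ 0 :=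
  norm_pos_iff.1 ht.1

lemma IsPseudoUniformizer.zpow_ne_one {t : 𝔽} (ht : IsPseudoUniformizer t) {d : ℤ} (hd : d ≠ 0) :
    t ^ d ≠ 1 := by
  intro h
  have h1 := congrArg norm h
  rw [norm_zpow, norm_one] at h1
  exact hd ((zpow_eq_one_iff_right₀ ht.1.le ht.2.ne).1 h1)

lemma IsPseudoUniformizer.one_sub_zpow_ne {t : 𝔽} (ht : IsPseudoUniformizer t) {d : ℤ}
    (hd : d ≠ 0) : 1 - t ^ d ≠ 0 :=
  sub_ne_zero.2 (ht.zpow_ne_one hd).symm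

lemma heckeOnBasis_eq {t : 𝔽} (ht : IsPseudoUniformizer t) (i : ℕ) (τ : InfSYT lam) :
    heckeOnBasis t i τ =
      diagCoef t (gap τ i) • basisVec τ + swapCoef t (gap τ i) • basisVec (simpleSwap i τ) := by
  have h0 := ht.ne_zero
  have h1 : (1 : 𝔽) - t ≠ 0 := by simpa using ht.one_sub_zpow_ne (d := 1) one_ne_zero
  have e : cont τ i - cont τ (i + 1) = -gap τ i := by unfold gap; ring
  have e' : cont τ (i + 1) - cont τ i = gap τ i := rfl
  unfold heckeOnBasis
  rw [ascends_iff, descends_iff, e, e']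
  rcases gap_cases τ i with ⟨h, h'⟩ | ⟨h, h'⟩ | h | h
  · rw [if_neg (by omega), if_neg (by omega), if_pos h', h]
    simp [diagCoef, swapCoef, div_self h1]
  · rw [if_neg (by omega), if_neg (by omega), if_neg h', h]
    have h2 : (1 : 𝔽) - t⁻¹ ≠ 0 := by simpa using ht.one_sub_zpow_ne (d := -1) (by decide)
    have h3 : (1 - t) / (1 - t⁻¹) = -t := by
      rw [div_eq_iff h2]; field_simp; ring
    simp [diagCoef, swapCoef, h3]
  · rw [if_pos h, swapCoef, if_pos h, one_smul, add_comm]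
    rfl
  · rw [if_neg (by omega), if_pos h, swapCoef, if_neg (by omega), if_pos h]
    have h2 := ht.one_sub_zpow_ne (d := gap τ i) (by omega)
    have h3 := ht.one_sub_zpow_ne (d := -gap τ i) (by omega)
    have h4 : t ^ gap τ i ≠ 0 := zpow_ne_zero _ h0
    have h5 : diagCoef t (gap τ i) = -(t ^ (-gap τ i) * ((1 - t) / (1 - t ^ (-gap τ i)))) := by
      rw [diagCoef, mul_div_assoc', ← neg_div, div_eq_div_iff h2 h3, zpow_neg]
      field_simp
      ring
    rw [h5]
    ext x
    simp only [ZeroAtInftyContinuousMap.add_apply, ZeroAtInftyContinuousMap.sub_apply,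
      ZeroAtInftyContinuousMap.smul_apply, smul_eq_mul]
    ring

lemma gap_ne_zero (τ : InfSYT lam) (i : ℕ) : gap τ i ≠ 0 := by
  rcases gap_cases τ i with h | h | h | h <;> omega

lemma gap_add_ne_zero (τ : InfSYT lam) (i : ℕ) : gap τ i + gap τ (i + 1) ≠ 0 := by
  have := cont_ne τ (i := i) (j := i + 2) (by omega) le_rfl
  unfold gap
  intro h
  apply this
  have e : i + 1 + 1 = i + 2 := rfl
  rw [e] at h
  omega

lemma isStandard_of_swapCoef {t : 𝔽} {τ : InfSYT lam} {i : ℕ} (h : swapCoef t (gap τ i) ≠ 0) :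
    IsStandard (swapFilling i τ) := by
  refine isStandard_of_gap ?_
  by_contra hc
  rw [not_or] at hc
  exact h (by rw [swapCoef, if_neg hc.1, if_neg hc.2])

lemma gap_swap_self {τ : InfSYT lam} {i : ℕ} (h : IsStandard (swapFilling i τ)) :
    gap (simpleSwap i τ) i = -gap τ i := by
  simp [gap, cont_simpleSwap h]

lemma gap_swap_succ {τ : InfSYT lam} {i : ℕ} (h : IsStandard (swapFilling i τ)) :
    gap (simpleSwap i τ) (i + 1) = gap τ i + gap τ (i + 1) := by
  have h1 : Equiv.swap i (i + 1) (i + 1 + 1) = i + 1 + 1 :=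
    Equiv.swap_apply_of_ne_of_ne (by omega) (by omega)
  simp only [gap, cont_simpleSwap h, h1, Equiv.swap_apply_right]
  ring

lemma gap_swap_pred {τ : InfSYT lam} {i : ℕ} (h : IsStandard (swapFilling (i + 1) τ)) :
    gap (simpleSwap (i + 1) τ) i = gap τ i + gap τ (i + 1) := by
  have h1 : Equiv.swap (i + 1) (i + 1 + 1) i = i :=
    Equiv.swap_apply_of_ne_of_ne (by omega) (by omega)
  simp only [gap, cont_simpleSwap h, h1, Equiv.swap_apply_left]
  ring

lemma gap_swap_far {τ : InfSYT lam} {i j : ℕ} (h : IsStandard (swapFilling i τ))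
    (hij : i + 1 < j ∨ j + 1 < i) : gap (simpleSwap i τ) j = gap τ j := by
  have h1 : Equiv.swap i (i + 1) j = j :=
    Equiv.swap_apply_of_ne_of_ne (by omega) (by omega)
  have h2 : Equiv.swap i (i + 1) (j + 1) = j + 1 :=
    Equiv.swap_apply_of_ne_of_ne (by omega) (by omega)
  simp only [gap, cont_simpleSwap h, h1, h2]

lemma swap_swap_self {τ : InfSYT lam} {i : ℕ} (h : IsStandard (swapFilling i τ)) :
    simpleSwap i (simpleSwap i τ) = τ := by
  have hv : swapFilling i (simpleSwap i τ) = τ.1 := by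
    ext p
    simp [swapFilling, simpleSwap_val h]
  refine Subtype.ext ?_
  rw [simpleSwap_val (by rw [hv]; exact τ.2), hv]

lemma simpleSwap_apply {τ : InfSYT lam} {i : ℕ} (h : IsStandard (swapFilling i τ)) (p : Box lam) :
    (simpleSwap i τ).1 p = Equiv.swap i (i + 1) (τ.1 p) := by
  rw [simpleSwap_val h]; rfl

lemma swapCoef_mul_neg {t : 𝔽} (ht : IsPseudoUniformizer t) {d : ℤ} (hd : d ≠ 0) :
    swapCoef t d * swapCoef t (-d) =
      t * ((1 - t ^ (d - 1)) * (1 - t ^ (d + 1))) / (1 - t ^ d) ^ 2 := by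
  have h0 := ht.ne_zero
  have h1 := ht.one_sub_zpow_ne hd
  have h2 := ht.one_sub_zpow_ne (neg_ne_zero.2 hd)
  have h3 : t ^ d ≠ 0 := zpow_ne_zero _ h0
  rcases lt_trichotomy d 0 with h | h | h
  · rcases eq_or_ne d (-1) with rfl | h'
    · simp [swapCoef]
    · rw [swapCoef, if_neg (by omega), if_pos (by omega), swapCoef, if_pos (by omega), mul_one]
      rw [div_eq_div_iff (pow_ne_zero 2 h2) (pow_ne_zero 2 h1)]
      simp only [zpow_add₀ h0, zpow_sub₀ h0, zpow_neg, zpow_one]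
      field_simp
      ring
  · exact absurd h hd
  · rcases eq_or_ne d 1 with rfl | h'
    · simp [swapCoef]
    · rw [swapCoef, if_pos (by omega), swapCoef, if_neg (by omega), if_pos (by omega), one_mul,
        neg_neg]

lemma diagCoef_braid_left {t : 𝔽} (ht : IsPseudoUniformizer t) {a b : ℤ} (ha : a ≠ 0)
    (hb : b ≠ 0) (hc : a + b ≠ 0) :
    diagCoef t a * diagCoef t b + diagCoef t (a + b) * diagCoef t (-a) =
      diagCoef t b * diagCoef t (a + b) := by
  have h0 := ht.ne_zero
  have na : t ^ a ≠ 0 := zpow_ne_zero _ h0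
  have nb : t ^ b ≠ 0 := zpow_ne_zero _ h0
  have ma := ht.one_sub_zpow_ne ha
  have mb := ht.one_sub_zpow_ne hb
  have mc := ht.one_sub_zpow_ne hc
  have ma' := ht.one_sub_zpow_ne (neg_ne_zero.2 ha)
  simp only [diagCoef, zpow_neg, zpow_add₀ h0] at mc ma' ⊢
  have : t ^ a - 1 ≠ 0 := by rw [← neg_sub]; exact neg_ne_zero.2 ma
  field_simp
  ring

lemma diagCoef_braid_right {t : 𝔽} (ht : IsPseudoUniformizer t) {a b : ℤ} (ha : a ≠ 0)
    (hb : b ≠ 0) (hc : a + b ≠ 0) :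
    diagCoef t a * diagCoef t b + diagCoef t (a + b) * diagCoef t (-b) =
      diagCoef t a * diagCoef t (a + b) := by
  have h := diagCoef_braid_left ht hb ha (by rwa [add_comm])
  rw [add_comm b a] at h
  rw [← h]; ring

lemma coef_braid {t : 𝔽} (ht : IsPseudoUniformizer t) {a b : ℤ} (ha : a ≠ 0)
    (hb : b ≠ 0) (hc : a + b ≠ 0) :
    diagCoef t a ^ 2 * diagCoef t b + swapCoef t a * swapCoef t (-a) * diagCoef t (a + b) =
      diagCoef t b ^ 2 * diagCoef t a + swapCoef t b * swapCoef t (-b) * diagCoef t (a + b) := by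
  have h0 := ht.ne_zero
  have ma := ht.one_sub_zpow_ne ha
  have mb := ht.one_sub_zpow_ne hb
  have mc := ht.one_sub_zpow_ne hc
  rw [swapCoef_mul_neg ht ha, swapCoef_mul_neg ht hb]
  simp only [diagCoef, zpow_add₀ h0, zpow_sub₀ h0, zpow_one] at mc ⊢
  field_simp
  ring

lemma swap_braid (i n : ℕ) :
    Equiv.swap i (i + 1) (Equiv.swap (i + 1) (i + 1 + 1) (Equiv.swap i (i + 1) n)) =
      Equiv.swap (i + 1) (i + 1 + 1) (Equiv.swap i (i + 1) (Equiv.swap (i + 1) (i + 1 + 1) n)) := by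
  have h1 : Equiv.swap i (i + 1) (i + 1 + 1) = i + 1 + 1 :=
    Equiv.swap_apply_of_ne_of_ne (by omega) (by omega)
  have h2 : Equiv.swap (i + 1) (i + 1 + 1) i = i :=
    Equiv.swap_apply_of_ne_of_ne (by omega) (by omega)
  by_cases e1 : n = i
  · subst e1; simp [h1, h2]
  by_cases e2 : n = i + 1
  · subst e2; simp [h1, h2]
  by_cases e3 : n = i + 1 + 1
  · subst e3; simp [h1, h2]
  rw [Equiv.swap_apply_of_ne_of_ne e1 e2, Equiv.swap_apply_of_ne_of_ne e2 e3,
    Equiv.swap_apply_of_ne_of_ne e1 e2, Equiv.swap_apply_of_ne_of_ne e2 e3]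

section Ultra

variable [IsUltrametricDist 𝔽]

lemma IsPseudoUniformizer.norm_one_sub_zpow {t : 𝔽} (ht : IsPseudoUniformizer t) {d : ℤ}
    (hd : d ≠ 0) : ‖1 - t ^ d‖ = max 1 (‖t‖ ^ d) := by
  have hn : ‖(1 : 𝔽)‖ ≠ ‖-t ^ d‖ := by
    rw [norm_one, norm_neg, norm_zpow]
    intro h
    exact hd ((zpow_eq_one_iff_right₀ ht.1.le ht.2.ne).1 h.symm)
  rw [sub_eq_add_neg, IsUltrametricDist.norm_add_eq_max_of_norm_ne_norm hn, norm_one, norm_neg,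
    norm_zpow]

lemma IsPseudoUniformizer.one_le_norm {t : 𝔽} (ht : IsPseudoUniformizer t) {d : ℤ}
    (hd : d ≠ 0) : 1 ≤ ‖1 - t ^ d‖ := by
  rw [ht.norm_one_sub_zpow hd]; exact le_max_left _ _

lemma IsPseudoUniformizer.norm_eq_one {t : 𝔽} (ht : IsPseudoUniformizer t) {d : ℤ}
    (hd : 0 < d) : ‖1 - t ^ d‖ = 1 := by
  rw [ht.norm_one_sub_zpow hd.ne']
  exact max_eq_left (zpow_le_one₀ ht.1 ht.2.le hd.le)

lemma norm_diagCoef_le {t : 𝔽} (ht : IsPseudoUniformizer t) {d : ℤ} (hd : d ≠ 0) :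
    ‖diagCoef t d‖ ≤ 1 := by
  have h1 : ‖1 - t‖ = 1 := by simpa using ht.norm_eq_one one_pos
  rw [diagCoef, norm_div, h1]
  exact div_le_one_of_le₀ (ht.one_le_norm hd) (norm_nonneg _)

lemma norm_swapCoef_le {t : 𝔽} (ht : IsPseudoUniformizer t) (d : ℤ) : ‖swapCoef t d‖ ≤ 1 := by
  unfold swapCoef
  split_ifs with h1 h2
  · rw [norm_one]
  · rw [norm_div, norm_mul, norm_mul, norm_pow, ht.norm_eq_one (by omega),
      ht.norm_eq_one (by omega), ht.norm_eq_one (by omega)]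
    simpa using ht.2.le
  · rw [norm_zero]; exact zero_le_one

lemma norm_heckeOnBasis_le {t : 𝔽} (ht : IsPseudoUniformizer t) (i : ℕ) (τ : InfSYT lam) :
    ‖(heckeOnBasis t i τ : SpechtHat 𝔽 lam)‖ ≤ 1 := by
  rw [heckeOnBasis_eq ht]
  refine (IsUltrametricDist.norm_add_le_max _ _).trans (max_le ?_ ?_)
  · rw [norm_smul]
    exact mul_le_one₀ (norm_diagCoef_le ht (gap_ne_zero τ i)) (norm_nonneg _) (norm_basisVec_le _)
  · rw [norm_smul]
    exact mul_le_one₀ (norm_swapCoef_le ht _) (norm_nonneg _) (norm_basisVec_le _)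

end Ultra

variable [CompleteSpace 𝔽] [IsUltrametricDist 𝔽]

/-- The bounded operator `T_i` on `Ŝ_λ`, sending `∑ c_τ e_τ` to `∑ c_τ T_i(e_τ)`. -/
noncomputable def heckeOp {t : 𝔽} (ht : IsPseudoUniformizer t) (lam : YoungDiagram) (i : ℕ) :
    SpechtHat 𝔽 lam →L[𝔽] SpechtHat 𝔽 lam :=
  extendBasis (heckeOnBasis t i) 1 (norm_heckeOnBasis_le ht i)

lemma heckeOp_basisVec {t : 𝔽} (ht : IsPseudoUniformizer t) (i : ℕ) (τ : InfSYT lam) :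
    heckeOp ht lam i (basisVec τ) =
      diagCoef t (gap τ i) • basisVec τ + swapCoef t (gap τ i) • basisVec (simpleSwap i τ) := by
  rw [heckeOp, extendBasis_basisVec, heckeOnBasis_eq ht]

lemma heckeOp_quadratic {t : 𝔽} (ht : IsPseudoUniformizer t) (i : ℕ) :
    (heckeOp ht lam i - 1) * (heckeOp ht lam i + t • 1) = 0 := by
  refine ext_basisVec fun τ => ?_
  have hd := gap_ne_zero τ i
  have h0 := ht.ne_zero
  have hx : t ^ gap τ i ≠ 0 := zpow_ne_zero _ h0
  have h1 := ht.one_sub_zpow_ne hd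
  have h1' : t ^ gap τ i - 1 ≠ 0 := sub_ne_zero.2 (ht.zpow_ne_one hd)
  have hV := swapCoef_mul_neg ht hd
  have hD : diagCoef t (-gap τ i) = 1 - t - diagCoef t (gap τ i) := by
    have h2 := ht.one_sub_zpow_ne (neg_ne_zero.2 hd)
    rw [diagCoef, diagCoef, zpow_neg]
    rw [zpow_neg] at h2
    field_simp
    ring
  have hDV : diagCoef t (gap τ i) ^ 2 + swapCoef t (gap τ i) * swapCoef t (-gap τ i) =
      (1 - t) * diagCoef t (gap τ i) + t := by
    rw [hV, diagCoef]
    simp only [zpow_add₀ h0, zpow_sub₀ h0, zpow_one]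
    field_simp
    ring
  ext x
  have hG : swapCoef t (gap τ i) * (diagCoef t (gap (simpleSwap i τ) i) *
        basisVec (simpleSwap i τ) x + swapCoef t (gap (simpleSwap i τ) i) *
        basisVec (simpleSwap i (simpleSwap i τ)) x) =
      swapCoef t (gap τ i) * (diagCoef t (-gap τ i) * basisVec (simpleSwap i τ) x +
        swapCoef t (-gap τ i) * basisVec τ x) := by
    by_cases h : swapCoef t (gap τ i) = 0
    · rw [h, zero_mul, zero_mul]
    · have hs := isStandard_of_swapCoef h
      rw [gap_swap_self hs, swap_swap_self hs]
  have e : ((heckeOp ht lam i - 1) * (heckeOp ht lam i + t • 1)) (basisVec τ) =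
      heckeOp ht lam i (heckeOp ht lam i (basisVec τ) + t • basisVec τ) -
        (heckeOp ht lam i (basisVec τ) + t • basisVec τ) := rfl
  rw [e]
  simp only [heckeOp_basisVec, map_add, map_smul, ZeroAtInftyContinuousMap.add_apply,
    ZeroAtInftyContinuousMap.sub_apply, ZeroAtInftyContinuousMap.smul_apply, smul_eq_mul,
    zero_apply, ZeroAtInftyContinuousMap.zero_apply]
  rw [hD] at hG
  linear_combination hG + basisVec τ x * hDV

lemma heckeOp_comm {t : 𝔽} (ht : IsPseudoUniformizer t) (i j : ℕ) (hij : i + 1 < j) :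
    heckeOp ht lam i * heckeOp ht lam j = heckeOp ht lam j * heckeOp ht lam i := by
  refine ext_basisVec fun τ => ?_
  ext x
  simp only [mul_apply_eq_comp, heckeOp_basisVec, map_add, map_smul,
    ZeroAtInftyContinuousMap.add_apply, ZeroAtInftyContinuousMap.smul_apply, smul_eq_mul]
  have hi : ∀ f : ℤ → 𝔽, swapCoef t (gap τ i) * f (gap (simpleSwap i τ) j) =
      swapCoef t (gap τ i) * f (gap τ j) := fun f => by
    by_cases h : swapCoef t (gap τ i) = 0
    · rw [h, zero_mul, zero_mul]
    · rw [gap_swap_far (isStandard_of_swapCoef h) (Or.inl hij)]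
  have hj : ∀ f : ℤ → 𝔽, swapCoef t (gap τ j) * f (gap (simpleSwap j τ) i) =
      swapCoef t (gap τ j) * f (gap τ i) := fun f => by
    by_cases h : swapCoef t (gap τ j) = 0
    · rw [h, zero_mul, zero_mul]
    · rw [gap_swap_far (isStandard_of_swapCoef h) (Or.inr hij)]
  have hE : swapCoef t (gap τ i) * swapCoef t (gap τ j) *
      basisVec (simpleSwap i (simpleSwap j τ)) x =
      swapCoef t (gap τ i) * swapCoef t (gap τ j) *
      basisVec (simpleSwap j (simpleSwap i τ)) x := by
    by_cases h : swapCoef t (gap τ i) = 0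
    · simp [h]
    by_cases h' : swapCoef t (gap τ j) = 0
    · simp [h']
    have hs := isStandard_of_swapCoef h
    have hs' := isStandard_of_swapCoef h'
    have hs1 : IsStandard (swapFilling j (simpleSwap i τ)) :=
      isStandard_of_swapCoef (t := t) (by rwa [gap_swap_far hs (Or.inl hij)])
    have hs2 : IsStandard (swapFilling i (simpleSwap j τ)) :=
      isStandard_of_swapCoef (t := t) (by rwa [gap_swap_far hs' (Or.inr hij)])
    have : simpleSwap i (simpleSwap j τ) = simpleSwap j (simpleSwap i τ) := by
      refine Subtype.ext (Equiv.ext fun p => ?_)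
      simp only [simpleSwap_apply hs, simpleSwap_apply hs', simpleSwap_apply hs1,
        simpleSwap_apply hs2, Equiv.swap_apply_def]
      split_ifs <;> omega
    rw [this]
  linear_combination (basisVec (simpleSwap j τ) x) * hj (diagCoef t) +
    (basisVec (simpleSwap i (simpleSwap j τ)) x) * hj (swapCoef t) -
    (basisVec (simpleSwap i τ) x) * hi (diagCoef t) -
    (basisVec (simpleSwap j (simpleSwap i τ)) x) * hi (swapCoef t) + hE

lemma heckeOp_braid {t : 𝔽} (ht : IsPseudoUniformizer t) (i : ℕ) :
    heckeOp ht lam i * heckeOp ht lam (i + 1) * heckeOp ht lam i =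
      heckeOp ht lam (i + 1) * heckeOp ht lam i * heckeOp ht lam (i + 1) := by
  refine ext_basisVec fun τ => ?_
  ext x
  simp only [mul_apply_eq_comp, heckeOp_basisVec, map_add, map_smul,
    ZeroAtInftyContinuousMap.add_apply, ZeroAtInftyContinuousMap.smul_apply, smul_eq_mul]
  have ha := gap_ne_zero τ i
  have hb := gap_ne_zero τ (i + 1)
  have hc := gap_add_ne_zero τ i
  set τ1 := simpleSwap i τ with hτ1
  set τ2 := simpleSwap (i + 1) τ with hτ2
  have hL : swapCoef t (gap τ i) *
      (diagCoef t (gap τ1 (i + 1)) * (diagCoef t (gap τ1 i) * basisVec τ1 x +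
          swapCoef t (gap τ1 i) * basisVec (simpleSwap i τ1) x) +
        swapCoef t (gap τ1 (i + 1)) *
          (diagCoef t (gap (simpleSwap (i + 1) τ1) i) * basisVec (simpleSwap (i + 1) τ1) x +
          swapCoef t (gap (simpleSwap (i + 1) τ1) i) *
            basisVec (simpleSwap i (simpleSwap (i + 1) τ1)) x)) =
      swapCoef t (gap τ i) *
      (diagCoef t (gap τ i + gap τ (i + 1)) * (diagCoef t (-gap τ i) * basisVec τ1 x +
          swapCoef t (-gap τ i) * basisVec τ x) +
        swapCoef t (gap τ i + gap τ (i + 1)) *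
          (diagCoef t (gap τ (i + 1)) * basisVec (simpleSwap (i + 1) τ1) x +
          swapCoef t (gap τ (i + 1)) *
            basisVec (simpleSwap i (simpleSwap (i + 1) τ1)) x)) := by
    by_cases h : swapCoef t (gap τ i) = 0
    · rw [h, zero_mul, zero_mul]
    have hs := isStandard_of_swapCoef h
    have e1 : gap τ1 (i + 1) = gap τ i + gap τ (i + 1) := gap_swap_succ hs
    have e2 : gap τ1 i = -gap τ i := gap_swap_self hs
    rw [show simpleSwap i τ1 = τ from swap_swap_self hs, e2]
    by_cases h' : swapCoef t (gap τ1 (i + 1)) = 0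
    · rw [← e1, h', zero_mul, zero_mul]
    have e3 : gap (simpleSwap (i + 1) τ1) i = gap τ (i + 1) := by
      rw [gap_swap_pred (isStandard_of_swapCoef h'), e1, e2]; ring
    rw [e3, e1]
  have hR : swapCoef t (gap τ (i + 1)) *
      (diagCoef t (gap τ2 i) * (diagCoef t (gap τ2 (i + 1)) * basisVec τ2 x +
          swapCoef t (gap τ2 (i + 1)) * basisVec (simpleSwap (i + 1) τ2) x) +
        swapCoef t (gap τ2 i) *
          (diagCoef t (gap (simpleSwap i τ2) (i + 1)) * basisVec (simpleSwap i τ2) x +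
          swapCoef t (gap (simpleSwap i τ2) (i + 1)) *
            basisVec (simpleSwap (i + 1) (simpleSwap i τ2)) x)) =
      swapCoef t (gap τ (i + 1)) *
      (diagCoef t (gap τ i + gap τ (i + 1)) * (diagCoef t (-gap τ (i + 1)) * basisVec τ2 x +
          swapCoef t (-gap τ (i + 1)) * basisVec τ x) +
        swapCoef t (gap τ i + gap τ (i + 1)) *
          (diagCoef t (gap τ i) * basisVec (simpleSwap i τ2) x +
          swapCoef t (gap τ i) *
            basisVec (simpleSwap (i + 1) (simpleSwap i τ2)) x)) := by
    by_cases h : swapCoef t (gap τ (i + 1)) = 0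
    · rw [h, zero_mul, zero_mul]
    have hs := isStandard_of_swapCoef h
    have e1 : gap τ2 i = gap τ i + gap τ (i + 1) := gap_swap_pred hs
    have e2 : gap τ2 (i + 1) = -gap τ (i + 1) := gap_swap_self hs
    rw [show simpleSwap (i + 1) τ2 = τ from swap_swap_self hs, e2]
    by_cases h' : swapCoef t (gap τ2 i) = 0
    · rw [← e1, h', zero_mul, zero_mul]
    have e3 : gap (simpleSwap i τ2) (i + 1) = gap τ i := by
      rw [gap_swap_succ (isStandard_of_swapCoef h'), e1, e2]; ring
    rw [e3, e1]
  have hL' : swapCoef t (gap τ (i + 1)) * (diagCoef t (gap τ2 i) * basisVec τ2 x +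
        swapCoef t (gap τ2 i) * basisVec (simpleSwap i τ2) x) =
      swapCoef t (gap τ (i + 1)) * (diagCoef t (gap τ i + gap τ (i + 1)) * basisVec τ2 x +
        swapCoef t (gap τ i + gap τ (i + 1)) * basisVec (simpleSwap i τ2) x) := by
    by_cases h : swapCoef t (gap τ (i + 1)) = 0
    · rw [h, zero_mul, zero_mul]
    rw [show gap τ2 i = _ from gap_swap_pred (isStandard_of_swapCoef h)]
  have hR' : swapCoef t (gap τ i) * (diagCoef t (gap τ1 (i + 1)) * basisVec τ1 x +
        swapCoef t (gap τ1 (i + 1)) * basisVec (simpleSwap (i + 1) τ1) x) =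
      swapCoef t (gap τ i) * (diagCoef t (gap τ i + gap τ (i + 1)) * basisVec τ1 x +
        swapCoef t (gap τ i + gap τ (i + 1)) * basisVec (simpleSwap (i + 1) τ1) x) := by
    by_cases h : swapCoef t (gap τ i) = 0
    · rw [h, zero_mul, zero_mul]
    rw [show gap τ1 (i + 1) = _ from gap_swap_succ (isStandard_of_swapCoef h)]
  have hE : swapCoef t (gap τ i) * swapCoef t (gap τ i + gap τ (i + 1)) *
        swapCoef t (gap τ (i + 1)) * basisVec (simpleSwap i (simpleSwap (i + 1) τ1)) x =
      swapCoef t (gap τ i) * swapCoef t (gap τ i + gap τ (i + 1)) *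
        swapCoef t (gap τ (i + 1)) * basisVec (simpleSwap (i + 1) (simpleSwap i τ2)) x := by
    by_cases h1 : swapCoef t (gap τ i) = 0
    · simp [h1]
    by_cases h2 : swapCoef t (gap τ (i + 1)) = 0
    · simp [h2]
    by_cases h3 : swapCoef t (gap τ i + gap τ (i + 1)) = 0
    · simp [h3]
    have s1 := isStandard_of_swapCoef h1
    have s2 := isStandard_of_swapCoef h2
    have s21 : IsStandard (swapFilling (i + 1) (simpleSwap i τ)) :=
      isStandard_of_swapCoef (t := t) (by rwa [gap_swap_succ s1])
    have s12 : IsStandard (swapFilling i (simpleSwap (i + 1) τ)) :=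
      isStandard_of_swapCoef (t := t) (by rwa [gap_swap_pred s2])
    have s121 : IsStandard (swapFilling i (simpleSwap (i + 1) (simpleSwap i τ))) := by
      refine isStandard_of_swapCoef (t := t) ?_
      rw [gap_swap_pred s21, gap_swap_succ s1, gap_swap_self s1]
      simpa using h2
    have s212 : IsStandard (swapFilling (i + 1) (simpleSwap i (simpleSwap (i + 1) τ))) := by
      refine isStandard_of_swapCoef (t := t) ?_
      rw [gap_swap_succ s12, gap_swap_pred s2, gap_swap_self s2]
      simpa using h1
    have : simpleSwap i (simpleSwap (i + 1) τ1) = simpleSwap (i + 1) (simpleSwap i τ2) := by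
      refine Subtype.ext (Equiv.ext fun p => ?_)
      rw [simpleSwap_apply s121, simpleSwap_apply s212, simpleSwap_apply s21,
        simpleSwap_apply s12, simpleSwap_apply s1, simpleSwap_apply s2]
      exact swap_braid i _
    rw [this]
  have key1 := diagCoef_braid_left ht ha hb hc
  have key2 := diagCoef_braid_right ht ha hb hc
  have key3 := coef_braid ht ha hb hc
  linear_combination hL - hR + diagCoef t (gap τ i) * hL' - diagCoef t (gap τ (i + 1)) * hR' +
    hE + basisVec τ x * key3 + swapCoef t (gap τ i) * basisVec τ1 x * key1 -
    swapCoef t (gap τ (i + 1)) * basisVec τ2 x * key2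

/-- The action of `H_∞` on `Ŝ_λ` by bounded operators; the generator `T_i` acts by `heckeOp i`. -/
noncomputable def heckeRep {t : 𝔽} (ht : IsPseudoUniformizer t) (lam : YoungDiagram) :
    HeckeAlgebra t →ₐ[𝔽] (SpechtHat 𝔽 lam →L[𝔽] SpechtHat 𝔽 lam) :=
  RingQuot.liftAlgHom 𝔽 ⟨FreeAlgebra.lift 𝔽 (heckeOp ht lam), by
    intro x y h
    induction h with
    | quadratic i =>
      simp only [map_mul, map_sub, map_add, map_one, map_zero, FreeAlgebra.lift_ι_apply,
        AlgHom.commutes]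
      rw [Algebra.algebraMap_eq_smul_one]
      exact heckeOp_quadratic ht i
    | braid i =>
      simpa only [map_mul, FreeAlgebra.lift_ι_apply] using heckeOp_braid ht i
    | comm i j h =>
      simpa only [map_mul, FreeAlgebra.lift_ι_apply] using heckeOp_comm ht i j h⟩

lemma heckeRep_gen {t : 𝔽} (ht : IsPseudoUniformizer t) (lam : YoungDiagram) (i : ℕ) :
    heckeRep ht lam (heckeGen t i) = heckeOp ht lam i := by
  rw [heckeRep, heckeGen, RingQuot.liftAlgHom_mkAlgHom_apply, FreeAlgebra.lift_ι_apply]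

end Specht
/-! ### Inversions, the inner product and the regularized trace -/

section Inversions

variable {lam : YoungDiagram}

lemma Box.row_le (p : Box lam) : p.row ≤ lam.colLen 0 := by
  rcases p.2 with h | h
  · exact h.le.trans (Nat.zero_le _)
  · have h1 : (p.1.1 - 1, 0) ∈ lam := lam.up_left_mem le_rfl (Nat.zero_le _) h
    have h2 := YoungDiagram.mem_iff_lt_colLen.1 h1
    change p.1.1 ≤ _
    omega

/-- The position of a box in the column reading order, as a number. -/
def colKey (p : Box lam) : ℕ := p.col * (lam.colLen 0 + 1) + p.row

/-- `colKey` is ordered by columns (left to right), and within a column from top to bottom. -/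
lemma colKey_lt_iff (p q : Box lam) :
    colKey p < colKey q ↔ p.col < q.col ∨ (p.col = q.col ∧ p.row < q.row) := by
  have hp := p.row_le
  have hq := q.row_le
  unfold colKey
  rcases lt_trichotomy p.col q.col with h | h | h
  · have : (p.col + 1) * (lam.colLen 0 + 1) ≤ q.col * (lam.colLen 0 + 1) :=
      Nat.mul_le_mul_right _ h
    constructor
    · intro _; exact Or.inl h
    · intro _; linarith
  · rw [h]; omega
  · have : (q.col + 1) * (lam.colLen 0 + 1) ≤ p.col * (lam.colLen 0 + 1) :=
      Nat.mul_le_mul_right _ h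
    constructor
    · intro h'; linarith
    · intro h'; omega

lemma colKey_injective : Function.Injective (colKey (lam := lam)) := by
  intro p q h
  have h1 := colKey_lt_iff p q
  have h2 := colKey_lt_iff q p
  rw [h] at h1 h2
  exact box_ext (by omega) (by omega)

instance (lam : YoungDiagram) : Infinite (Box lam) :=
  Infinite.of_injective (fun n : ℕ => (⟨(0, n), Or.inl rfl⟩ : Box lam)) fun _ _ h =>
    congrArg Box.col h

instance (lam : YoungDiagram) : Infinite (Set.range (colKey (lam := lam))) :=
  (Set.infinite_range_of_injective colKey_injective).to_subtype

/-- The filling that numbers the boxes of `λ^(∞)` column by column (left to right), each column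
from top to bottom. -/
noncomputable def colFilling (lam : YoungDiagram) : Box lam ≃ ℕ := by
  classical
  exact (Equiv.ofInjective colKey colKey_injective).trans
    (Nat.Subtype.orderIsoOfNat (Set.range (colKey (lam := lam)))).symm.toEquiv

lemma colFilling_lt_iff (p q : Box lam) :
    colFilling lam p < colFilling lam q ↔ p.col < q.col ∨ (p.col = q.col ∧ p.row < q.row) := by
  rw [← colKey_lt_iff]
  unfold colFilling
  exact (Nat.Subtype.orderIsoOfNat (Set.range (colKey (lam := lam)))).symm.lt_iff_lt

/-- The column-standard tableau `τ_λ`. -/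
noncomputable def colStandard (lam : YoungDiagram) : InfSYT lam :=
  ⟨colFilling lam, fun p q _ h => (colFilling_lt_iff p q).2 (Or.inl h),
    fun p q h h' => (colFilling_lt_iff p q).2 (Or.inr ⟨h, h'⟩)⟩

/-- The set `Inv(τ)` of inversion pairs: pairs of boxes `(□₁, □₂)` with `τ_λ(□₁) < τ_λ(□₂)` and
`τ(□₁) > τ(□₂)`. -/
def invPairs (τ : InfSYT lam) : Set (Box lam × Box lam) :=
  {x | (colStandard lam).1 x.1 < (colStandard lam).1 x.2 ∧ τ.1 x.2 < τ.1 x.1}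

/-- The content gap `c(□₂) - c(□₁)` of a pair of boxes. -/
def pairGap (x : Box lam × Box lam) : ℤ := x.2.content - x.1.content

lemma mem_invPairs {τ : InfSYT lam} {x : Box lam × Box lam} (h : x ∈ invPairs τ) :
    x.1.col < x.2.col ∧ x.2.row < x.1.row := by
  obtain ⟨p, q⟩ := x
  obtain ⟨h1, h2⟩ := h
  change p.col < q.col ∧ q.row < p.row
  change τ.1 q < τ.1 p at h2
  replace h1 : p.col < q.col ∨ (p.col = q.col ∧ p.row < q.row) := (colFilling_lt_iff p q).1 h1
  by_contra hc
  have hne : p ≠ q := fun e => by rw [e] at h2; exact lt_irrefl _ h2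
  have := τ.2.lt_of_le (p := p) (q := q) (by omega) (by omega) hne
  omega

lemma two_le_pairGap {τ : InfSYT lam} {x : Box lam × Box lam} (h : x ∈ invPairs τ) :
    2 ≤ pairGap x := by
  have := mem_invPairs h
  simp only [pairGap, Box.content]
  omega

lemma invPairs_finite (τ : InfSYT lam) : (invPairs τ).Finite := by
  have hfin : {p : Box lam | p.row ≠ 0}.Finite := by
    refine Set.Finite.of_finite_image (f := fun p : Box lam => (p.row - 1, p.col))
      (lam.cells.finite_toSet.subset ?_) ?_
    · rintro _ ⟨p, hp, rfl⟩
      exact p.2.resolve_left hp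
    · intro p hp q hq h
      have h1 : p.row - 1 = q.row - 1 := (Prod.mk.inj h).1
      have h2 : p.col = q.col := (Prod.mk.inj h).2
      have hp' : p.row ≠ 0 := hp
      have hq' : q.row ≠ 0 := hq
      exact box_ext (by omega) h2
  have hq : ∀ p : Box lam, {q : Box lam | τ.1 q < τ.1 p}.Finite := fun p =>
    (Set.finite_Iio (τ.1 p)).preimage τ.1.injective.injOn
  refine (hfin.biUnion fun p _ => (hq p).image (Prod.mk p)).subset ?_
  rintro ⟨p, q⟩ h
  have h' := mem_invPairs h
  refine Set.mem_biUnion (x := p) ?_ ⟨q, h.2, rfl⟩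
  change p.row ≠ 0
  change p.col < q.col ∧ q.row < p.row at h'
  omega

lemma invPairs_colStandard : invPairs (colStandard lam) = ∅ :=
  Set.eq_empty_of_forall_notMem fun _ h => lt_asymm h.1 h.2

lemma invPairs_simpleSwap {τ : InfSYT lam} {i : ℕ} (h : Ascends i τ) :
    invPairs (simpleSwap i τ) = insert (pos τ i, pos τ (i + 1)) (invPairs τ) := by
  have hlt : (colStandard lam).1 (pos τ i) < (colStandard lam).1 (pos τ (i + 1)) :=
    (colFilling_lt_iff _ _).2 (Or.inl h.2.1)
  have hpos : ∀ {p : Box lam} {j : ℕ}, τ.1 p = j → p = pos τ j := fun {p j} e => by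
    rw [← e]; exact (τ.1.symm_apply_apply p).symm
  ext ⟨p, q⟩
  simp only [invPairs, Set.mem_insert_iff, Set.mem_ofPred_eq, Prod.mk.injEq, simpleSwap_apply h.1]
  constructor
  · rintro ⟨h1, h2⟩
    by_cases hc : τ.1 p = i ∧ τ.1 q = i + 1
    · exact Or.inl ⟨hpos hc.1, hpos hc.2⟩
    · refine Or.inr ⟨h1, ?_⟩
      simp only [Equiv.swap_apply_def] at h2
      split_ifs at h2 <;> omega
  · rintro (⟨rfl, rfl⟩ | ⟨h1, h2⟩)
    · refine ⟨hlt, ?_⟩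
      simp
    · refine ⟨h1, ?_⟩
      have hc : ¬ (τ.1 p = i + 1 ∧ τ.1 q = i) := by
        rintro ⟨e1, e2⟩
        rw [hpos e1, hpos e2] at h1
        exact lt_asymm h1 hlt
      simp only [Equiv.swap_apply_def]
      split_ifs <;> omega

lemma notMem_invPairs (τ : InfSYT lam) (i : ℕ) : (pos τ i, pos τ (i + 1)) ∉ invPairs τ := by
  intro h
  have := h.2
  simp at this

end Inversions

section Form

variable {𝔽 : Type*} [NontriviallyNormedField 𝔽] {lam : YoungDiagram}

/-- The scalar `a(τ) = (e_τ, e_τ)_λ`, a product over the inversion pairs of `τ`. -/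
noncomputable def sqNorm (t : 𝔽) (τ : InfSYT lam) : 𝔽 :=
  ∏ᶠ x ∈ invPairs τ,
    t * ((1 - t ^ (pairGap x - 1)) * (1 - t ^ (pairGap x + 1))) / (1 - t ^ pairGap x) ^ 2

/-- `a(τ_λ) = 1`. -/
lemma sqNorm_colStandard (t : 𝔽) : sqNorm t (colStandard lam) = 1 := by
  rw [sqNorm, invPairs_colStandard, finprod_mem_empty]

/-- The recursion that determines `a` from `a(τ_λ) = 1`. -/
lemma sqNorm_simpleSwap {t : 𝔽} (ht : IsPseudoUniformizer t) {τ : InfSYT lam} {i : ℕ}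
    (h : Ascends i τ) :
    sqNorm t (simpleSwap i τ) =
      ((t ^ (cont τ (i + 1) - cont τ i) - t) * (t ^ (cont τ (i + 1) - cont τ i + 1) - 1)) /
        (t ^ (cont τ (i + 1) - cont τ i) - 1) ^ 2 * sqNorm t τ := by
  rw [sqNorm, invPairs_simpleSwap h, finprod_mem_insert _ (notMem_invPairs τ i) (invPairs_finite τ)]
  congr 1
  have e : pairGap (pos τ i, pos τ (i + 1)) = gap τ i := rfl
  have e' : cont τ (i + 1) - cont τ i = gap τ i := rfl
  have h0 := ht.ne_zero
  have h1 := ht.one_sub_zpow_ne (gap_ne_zero τ i)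
  have h2 : t ^ gap τ i - 1 ≠ 0 := by rw [← neg_sub]; exact neg_ne_zero.2 h1
  rw [e, e', zpow_add₀ h0, zpow_sub₀ h0, zpow_one, div_eq_div_iff (pow_ne_zero 2 h1)
    (pow_ne_zero 2 h2)]
  field_simp
  ring

lemma sqNorm_ne_zero {t : 𝔽} (ht : IsPseudoUniformizer t) (τ : InfSYT lam) :
    sqNorm t τ ≠ 0 := by
  refine finprod_mem_induction (fun y : 𝔽 => y ≠ 0) one_ne_zero (fun _ _ => mul_ne_zero) ?_
  intro x hx
  have := two_le_pairGap hx
  exact div_ne_zero (mul_ne_zero ht.ne_zero (mul_ne_zero (ht.one_sub_zpow_ne (by omega))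
    (ht.one_sub_zpow_ne (by omega)))) (pow_ne_zero 2 (ht.one_sub_zpow_ne (by omega)))

lemma swapCoef_sqNorm {t : 𝔽} (ht : IsPseudoUniformizer t) (i : ℕ) (τ : InfSYT lam)
    (hs : 2 ≤ gap τ i) :
    sqNorm t (simpleSwap i τ) = swapCoef t (-gap τ i) * sqNorm t τ := by
  have e' : cont τ (i + 1) - cont τ i = gap τ i := rfl
  have h1 := ht.one_sub_zpow_ne (gap_ne_zero τ i)
  have h2 : t ^ gap τ i - 1 ≠ 0 := by rw [← neg_sub]; exact neg_ne_zero.2 h1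
  have h0 := ht.ne_zero
  rw [sqNorm_simpleSwap ht ((ascends_iff τ i).2 hs), e', swapCoef, if_neg (by omega),
    if_pos (by omega), neg_neg]
  congr 1
  rw [zpow_add₀ h0, zpow_sub₀ h0, zpow_one, div_eq_div_iff (pow_ne_zero 2 h2) (pow_ne_zero 2 h1)]
  field_simp
  ring

lemma swapCoef_sqNorm_symm {t : 𝔽} (ht : IsPseudoUniformizer t) (i : ℕ) (τ : InfSYT lam)
    (hs : IsStandard (swapFilling i τ)) (hg : 2 ≤ gap τ i ∨ gap τ i ≤ -2) :
    swapCoef t (gap τ i) * sqNorm t (simpleSwap i τ) =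
      swapCoef t (gap (simpleSwap i τ) i) * sqNorm t τ := by
  rw [gap_swap_self hs]
  rcases hg with h | h
  · rw [swapCoef_sqNorm ht i τ h, swapCoef, if_pos h, one_mul]
  · have h' : 2 ≤ gap (simpleSwap i τ) i := by rw [gap_swap_self hs]; omega
    have := swapCoef_sqNorm ht i (simpleSwap i τ) h'
    rw [swap_swap_self hs, gap_swap_self hs, neg_neg] at this
    have e1 : swapCoef t (-gap τ i) = 1 := by rw [swapCoef, if_pos (by omega)]
    rw [this, e1, one_mul]

variable [IsUltrametricDist 𝔽]

lemma norm_sqNorm_le {t : 𝔽} (ht : IsPseudoUniformizer t) (τ : InfSYT lam) :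
    ‖sqNorm t τ‖ ≤ 1 := by
  refine finprod_mem_induction (fun y : 𝔽 => ‖y‖ ≤ 1) norm_one.le ?_ ?_
  · intro x y hx hy
    rw [norm_mul]
    exact mul_le_one₀ hx (norm_nonneg _) hy
  · intro x hx
    have := two_le_pairGap hx
    rw [norm_div, norm_mul, norm_mul, norm_pow, ht.norm_eq_one (by omega),
      ht.norm_eq_one (by omega), ht.norm_eq_one (by omega)]
    simpa using ht.2.le

variable [CompleteSpace 𝔽]

lemma summable_form {t : 𝔽} (ht : IsPseudoUniformizer t) (f g : SpechtHat 𝔽 lam) :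
    Summable fun τ => f τ * g τ * sqNorm t τ := by
  refine NonarchimedeanAddGroup.summable_of_tendsto_cofinite_zero ?_
  have h := (tendsto_cofinite f).norm.mul_const ‖g‖
  rw [norm_zero, zero_mul] at h
  refine squeeze_zero_norm (fun τ => ?_) h
  rw [norm_mul, norm_mul]
  refine (mul_le_of_le_one_right (by positivity) (norm_sqNorm_le ht τ)).trans ?_
  exact mul_le_mul_of_nonneg_left (norm_apply_le g τ) (norm_nonneg _)

/-- The inner product `(-,-)_λ` on `Ŝ_λ`: the continuous symmetric bilinear form
`(∑ α_τ e_τ, ∑ β_τ e_τ)_λ = ∑ α_τ β_τ a(τ)`. -/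
noncomputable def innerForm {t : 𝔽} (ht : IsPseudoUniformizer t) (lam : YoungDiagram) :
    SpechtHat 𝔽 lam →L[𝔽] SpechtHat 𝔽 lam →L[𝔽] 𝔽 :=
  LinearMap.mkContinuous₂
    (LinearMap.mk₂ 𝔽 (fun f g => ∑' τ, f τ * g τ * sqNorm t τ)
      (fun f f' g => by
        rw [← (summable_form ht f g).tsum_add (summable_form ht f' g)]
        exact tsum_congr fun τ => by rw [ZeroAtInftyContinuousMap.add_apply]; ring)
      (fun c f g => by
        rw [smul_eq_mul, ← tsum_mul_left]
        exact tsum_congr fun τ => by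
          rw [ZeroAtInftyContinuousMap.smul_apply, smul_eq_mul]; ring)
      (fun f g g' => by
        rw [← (summable_form ht f g).tsum_add (summable_form ht f g')]
        exact tsum_congr fun τ => by rw [ZeroAtInftyContinuousMap.add_apply]; ring)
      (fun c f g => by
        rw [smul_eq_mul, ← tsum_mul_left]
        exact tsum_congr fun τ => by
          rw [ZeroAtInftyContinuousMap.smul_apply, smul_eq_mul]; ring)) 1
    fun f g => by
      have : Nonempty (InfSYT lam) := ⟨colStandard lam⟩
      refine IsUltrametricDist.norm_tsum_le_of_forall_le fun τ => ?_
      rw [norm_mul, norm_mul, one_mul]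
      refine (mul_le_of_le_one_right (by positivity) (norm_sqNorm_le ht τ)).trans ?_
      exact mul_le_mul (norm_apply_le f τ) (norm_apply_le g τ) (norm_nonneg _) (norm_nonneg _)

lemma innerForm_apply {t : 𝔽} (ht : IsPseudoUniformizer t) (f g : SpechtHat 𝔽 lam) :
    innerForm ht lam f g = ∑' τ, f τ * g τ * sqNorm t τ := rfl

lemma innerForm_basisVec_right {t : 𝔽} (ht : IsPseudoUniformizer t) (f : SpechtHat 𝔽 lam)
    (τ : InfSYT lam) : innerForm ht lam f (basisVec τ) = f τ * sqNorm t τ := by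
  rw [innerForm_apply, tsum_eq_single τ, basisVec_self, mul_one]
  intro x hx
  rw [basisVec_ne hx, mul_zero, zero_mul]

lemma innerForm_symm {t : 𝔽} (ht : IsPseudoUniformizer t) (f g : SpechtHat 𝔽 lam) :
    innerForm ht lam f g = innerForm ht lam g f := by
  rw [innerForm_apply, innerForm_apply]
  exact tsum_congr fun τ => by rw [mul_comm (f τ)]

/-- The form is non-degenerate. -/
lemma innerForm_nondegenerate {t : 𝔽} (ht : IsPseudoUniformizer t) (f : SpechtHat 𝔽 lam)
    (hf : ∀ g, innerForm ht lam f g = 0) : f = 0 := by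
  ext τ
  have h := hf (basisVec τ)
  rw [innerForm_basisVec_right] at h
  exact (mul_eq_zero.1 h).resolve_right (sqNorm_ne_zero ht τ)

/-- The operators `T_i` are self-adjoint for the form. -/
lemma innerForm_heckeOp {t : 𝔽} (ht : IsPseudoUniformizer t) (i : ℕ) (f g : SpechtHat 𝔽 lam) :
    innerForm ht lam (heckeOp ht lam i f) g = innerForm ht lam f (heckeOp ht lam i g) := by
  have hb : ∀ τ γ : InfSYT lam,
      innerForm ht lam (heckeOp ht lam i (basisVec τ)) (basisVec γ) =
        innerForm ht lam (basisVec τ) (heckeOp ht lam i (basisVec γ)) := by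
    intro τ γ
    rw [innerForm_symm ht (basisVec τ), innerForm_basisVec_right, innerForm_basisVec_right,
      heckeOp_basisVec, heckeOp_basisVec]
    simp only [ZeroAtInftyContinuousMap.add_apply, ZeroAtInftyContinuousMap.smul_apply,
      smul_eq_mul]
    by_cases h1 : γ = τ
    · rw [h1]
    have h1' : τ ≠ γ := fun e => h1 e.symm
    rw [basisVec_ne h1, basisVec_ne h1', mul_zero, mul_zero, zero_add, zero_add]
    have key : ∀ {σ ρ : InfSYT lam}, ρ ≠ σ →
        swapCoef t (gap σ i) * (basisVec (simpleSwap i σ) : SpechtHat 𝔽 lam) ρ * sqNorm t ρ ≠ 0 →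
        simpleSwap i σ = ρ ∧ IsStandard (swapFilling i σ) := by
      intro σ ρ _ hne
      refine ⟨?_, isStandard_of_swapCoef (t := t) fun h => hne (by rw [h, zero_mul, zero_mul])⟩
      by_contra hc
      exact hne (by rw [basisVec_ne fun e => hc e.symm, mul_zero, zero_mul])
    have main : ∀ {σ ρ : InfSYT lam}, ρ ≠ σ → simpleSwap i σ = ρ → IsStandard (swapFilling i σ) →
        swapCoef t (gap σ i) * (basisVec (simpleSwap i σ) : SpechtHat 𝔽 lam) ρ * sqNorm t ρ =
        swapCoef t (gap ρ i) * (basisVec (simpleSwap i ρ) : SpechtHat 𝔽 lam) σ * sqNorm t σ := by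
      intro σ ρ _ e hs
      subst e
      rw [swap_swap_self hs, basisVec_self, basisVec_self, mul_one, mul_one]
      have hself := gap_swap_self hs
      rcases gap_cases σ i with h | h | h | h
      · have e1 : swapCoef t (gap σ i) = 0 := by rw [h.1]; simp [swapCoef]
        have e2 : swapCoef t (gap (simpleSwap i σ) i) = 0 := by rw [hself, h.1]; simp [swapCoef]
        rw [e1, e2, zero_mul, zero_mul]
      · have e1 : swapCoef t (gap σ i) = 0 := by rw [h.1]; simp [swapCoef]
        have e2 : swapCoef t (gap (simpleSwap i σ) i) = 0 := by rw [hself, h.1]; simp [swapCoef]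
        rw [e1, e2, zero_mul, zero_mul]
      · exact swapCoef_sqNorm_symm ht i σ hs (Or.inl h)
      · exact swapCoef_sqNorm_symm ht i σ hs (Or.inr h)
    by_cases hA : swapCoef t (gap τ i) * (basisVec (simpleSwap i τ) : SpechtHat 𝔽 lam) γ *
        sqNorm t γ = 0
    · by_cases hB : swapCoef t (gap γ i) * (basisVec (simpleSwap i γ) : SpechtHat 𝔽 lam) τ *
          sqNorm t τ = 0
      · rw [hA, hB]
      · obtain ⟨e, hs⟩ := key h1' hB
        exact (main h1' e hs).symm
    · obtain ⟨e, hs⟩ := key h1 hA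
      exact main h1 e hs
  have hs : ∀ f : SpechtHat 𝔽 lam, Summable fun τ => f τ • (basisVec τ : SpechtHat 𝔽 lam) :=
    fun f => summable_smul basisVec 1 norm_basisVec_le f
  have hr : ∀ (τ : InfSYT lam) (g : SpechtHat 𝔽 lam),
      innerForm ht lam (heckeOp ht lam i (basisVec τ)) g =
        innerForm ht lam (basisVec τ) (heckeOp ht lam i g) := by
    intro τ g
    rw [← tsum_basisVec g, ContinuousLinearMap.map_tsum _ (hs g),
      ContinuousLinearMap.map_tsum _ (hs g), ContinuousLinearMap.map_tsum _
        ((hs g).mapL (heckeOp ht lam i))]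
    exact tsum_congr fun γ => by rw [map_smul, map_smul, map_smul, hb]
  rw [innerForm_symm ht f, innerForm_symm ht _ g, ← tsum_basisVec f,
    ContinuousLinearMap.map_tsum _ (hs f), ContinuousLinearMap.map_tsum _ (hs f),
    ContinuousLinearMap.map_tsum _ ((hs f).mapL (heckeOp ht lam i))]
  exact tsum_congr fun γ => by
    rw [map_smul, map_smul, map_smul, innerForm_symm ht g, hr, innerForm_symm ht (basisVec γ)]

/-- The renormalized basis vector `ẽ_τ`. -/
noncomputable def renormVec (t : 𝔽) (τ : InfSYT lam) : SpechtHat 𝔽 lam :=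
  (∏ᶠ x ∈ invPairs τ, (1 - t ^ pairGap x) / (1 - t ^ (pairGap x + 1))) • basisVec τ

/-- The term `(A ẽ_τ, ẽ_τ)_λ` of the trace series of a bounded operator `A` on `Ŝ_λ`. -/
noncomputable def traceTerm {t : 𝔽} (ht : IsPseudoUniformizer t)
    (A : SpechtHat 𝔽 lam →L[𝔽] SpechtHat 𝔽 lam) (τ : InfSYT lam) : 𝔽 :=
  innerForm ht lam (A (renormVec t τ)) (renormVec t τ)

/-- The regularized trace `Γ_λ(X) = ∑_τ (X ẽ_τ, ẽ_τ)_λ` of `X ∈ H_∞`. -/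
noncomputable def regTrace {t : 𝔽} (ht : IsPseudoUniformizer t) (lam : YoungDiagram)
    (X : HeckeAlgebra t) : 𝔽 :=
  ∑' τ : InfSYT lam, traceTerm ht (heckeRep ht lam X) τ

end Form

end InfHecke

namespace InfHecke

/-! ### Tableaux with few inversions are finite in number -/

section Finiteness

variable {lam : YoungDiagram}

/-! Inversions control everything. Since `|t| < 1`, the element `1 - t ^ k` has absolute value one
for every `k > 0`. The content gap of an inversion pair is at least two, so each factor of `a(τ)` is
`t` times an element of absolute value one, and `|a(τ)|` is exactly `|t|` to the number of
inversions of `τ` (`norm_sqNorm`). The scalar that renormalizes `e_τ` is made of the same kind of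
units, so it costs nothing (`norm_renormVec_le`). The form is diagonal in the basis, hence `(A ẽ_τ,
ẽ_τ)` involves only a diagonal coefficient of `A`, and its size is at most `‖A‖ |t| ^ #Inv(τ)`
(`norm_traceTerm_le`).

Over a complete ultrametric field, a family is summable as soon as it tends to zero along the
cofinite filter. What has to be shown is therefore combinatorial: only finitely many tableaux have
at most `n` inversions (`finite_ncard_invPairs_le`). A tableau is determined by its labels on the
finitely many boxes below the infinite row (`eq_of_eqOn_row_ne_zero`), and the label of a box
exceeds its label in `τ_λ` by at most the number of inversions (`apply_le_colStandard_add`), so only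
finitely many choices remain.

For integrality, the matrix coefficients of each `T_i` have absolute value at most one, so `T_i` has
operator norm at most one. Products and `𝒪`-combinations inherit this bound, the latter by the
ultrametric inequality (`norm_heckeRep_le`). Every term of the trace series is then in `𝒪`, and so
is the sum. -/

lemma finite_row_ne_zero (lam : YoungDiagram) : {p : Box lam | p.row ≠ 0}.Finite := by
  -- Moving up by one row identifies these boxes with the cells of `λ`; the truncated subtraction is
  -- injective because the row is nonzero.
  refine Set.Finite.of_finite_image (f := fun p : Box lam => (p.row - 1, p.col))
    (lam.cells.finite_toSet.subset ?_) ?_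
  · rintro _ ⟨p, hp, rfl⟩
    exact p.2.resolve_left hp
  · intro p hp q hq h
    have h1 : p.row - 1 = q.row - 1 := (Prod.mk.inj h).1
    have h2 : p.col = q.col := (Prod.mk.inj h).2
    have hp' : p.row ≠ 0 := hp
    have hq' : q.row ≠ 0 := hq
    exact box_ext (by omega) h2

/-- A box precedes at most as many boxes in `τ` as it does in `τ_λ`, up to inversions. -/
lemma apply_le_colStandard_add (τ : InfSYT lam) (p : Box lam) :
    τ.1 p ≤ (colStandard lam).1 p + (invPairs τ).ncard := by
  classical
  -- Labels start at `0`, so the label of `p` is the number of boxes with a smaller label. A box `q`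
  -- that precedes `p` in `τ` either precedes it in `τ_λ` as well or forms the inversion `(p, q)`.
  have hsub : (Finset.range (τ.1 p)).image τ.1.symm ⊆
      (Finset.range ((colStandard lam).1 p)).image (colStandard lam).1.symm ∪
        (invPairs_finite τ).toFinset.image Prod.snd := by
    intro q hq
    obtain ⟨n, hn, rfl⟩ := Finset.mem_image.1 hq
    have hn' : n < τ.1 p := Finset.mem_range.1 hn
    set q := τ.1.symm n
    have hqn : τ.1 q = n := τ.1.apply_symm_apply n
    rw [Finset.mem_union]
    rcases lt_trichotomy ((colStandard lam).1 q) ((colStandard lam).1 p) with h | h | h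
    · exact Or.inl (Finset.mem_image.2 ⟨_, Finset.mem_range.2 h, Equiv.symm_apply_apply _ _⟩)
    · have := (colStandard lam).1.injective h
      rw [this] at hqn
      omega
    · refine Or.inr (Finset.mem_image.2 ⟨(p, q), (invPairs_finite τ).mem_toFinset.2 ⟨h, ?_⟩, rfl⟩)
      change τ.1 q < τ.1 p
      omega
  have h1 := (Finset.card_le_card hsub).trans (Finset.card_union_le _ _)
  rw [Finset.card_image_of_injective _ τ.1.symm.injective, Finset.card_range,
    Finset.card_image_of_injective _ (colStandard lam).1.symm.injective, Finset.card_range] at h1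
  -- All inversions are projected to their second box, not just those that start at `p`. This may
  -- overcount, which is harmless for an upper bound.
  refine h1.trans (Nat.add_le_add_left (Finset.card_image_le.trans ?_) _)
  rw [Set.ncard_eq_toFinset_card _ (invPairs_finite τ)]

/-- A standard tableau is determined by its labels outside the infinite row. -/
lemma eq_of_eqOn_row_ne_zero {τ τ' : InfSYT lam}
    (h : ∀ p : Box lam, p.row ≠ 0 → τ.1 p = τ'.1 p) : τ = τ' := by
  refine Subtype.ext (Equiv.ext fun p => ?_)
  by_cases hp : p.row = 0
  -- The infinite row carries exactly the labels not used elsewhere, in increasing order, so its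
  -- filling is forced by the other rows.
  · let r : ℕ → Box lam := fun n => ⟨(0, n), Or.inl rfl⟩
    have hr : ∀ q : Box lam, q.row = 0 → r q.col = q := fun q hq => box_ext hq.symm rfl
    have hmono : ∀ σ : InfSYT lam, StrictMono fun n => σ.1 (r n) :=
      fun σ m n hmn => σ.2.row_lt _ _ rfl hmn
    have hrange : ∀ σ : InfSYT lam,
        Set.range (fun n => σ.1 (r n)) = (σ.1 '' {q : Box lam | q.row ≠ 0})ᶜ := by
      intro σ
      ext n
      constructor
      · rintro ⟨m, rfl⟩ ⟨q, hq, e⟩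
        exact hq (by rw [σ.1.injective e]; rfl)
      · intro hn
        have h0 : (pos σ n).row = 0 := by
          by_contra hc
          exact hn ⟨pos σ n, hc, apply_pos σ n⟩
        exact ⟨(pos σ n).col, by change σ.1 (r _) = n; rw [hr _ h0, apply_pos]⟩
    have himage : τ.1 '' {q : Box lam | q.row ≠ 0} = τ'.1 '' {q : Box lam | q.row ≠ 0} :=
      Set.image_congr fun q hq => h q hq
    -- Strictly increasing sequences of naturals with the same range coincide.
    have key := ((hmono τ).range_inj (hmono τ')).1 (by rw [hrange, hrange, himage])
    rw [← hr p hp]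
    exact congrFun key p.col
  · exact h p hp

/-- Restriction to the boxes outside the infinite row is injective on tableaux, and a bound on the
inversions confines the restricted labels to a finite product of initial intervals of `ℕ`. -/
lemma finite_ncard_invPairs_le (lam : YoungDiagram) (n : ℕ) :
    {τ : InfSYT lam | (invPairs τ).ncard ≤ n}.Finite := by
  have := (finite_row_ne_zero lam).to_subtype
  refine Set.Finite.of_finite_image
    (f := fun τ (p : {p : Box lam | p.row ≠ 0}) => τ.1 p.1) ?_ ?_
  · refine (Set.Finite.pi' (t := fun p : {p : Box lam | p.row ≠ 0} =>
      Set.Iic ((colStandard lam).1 p.1 + n)) fun p => Set.finite_Iic _).subset ?_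
    rintro _ ⟨τ, hτ, rfl⟩ p
    exact (apply_le_colStandard_add τ p.1).trans (Nat.add_le_add_left hτ _)
  · intro τ _ τ' _ h
    exact eq_of_eqOn_row_ne_zero fun p hp => congrFun h ⟨p, hp⟩

/-- This is the finiteness statement in the form needed to make `|t| ^ #Inv(τ)` tend to zero along
the cofinite filter. -/
lemma tendsto_ncard_invPairs (lam : YoungDiagram) :
    Filter.Tendsto (fun τ : InfSYT lam => (invPairs τ).ncard) Filter.cofinite Filter.atTop := by
  refine Filter.tendsto_atTop.2 fun n => ?_
  filter_upwards [(finite_ncard_invPairs_le lam n).compl_mem_cofinite] with τ hτ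
  exact (lt_of_not_ge fun h => hτ h).le

end Finiteness

/-! ### Norm estimates, convergence and integrality of the trace series -/

section Trace

variable {𝔽 : Type*} [NontriviallyNormedField 𝔽] [IsUltrametricDist 𝔽] {lam : YoungDiagram}

/-- Each inversion contributes `t` times a unit of the valuation ring. The equality sharpens
`norm_sqNorm_le` and supplies the decay of the trace series. -/
lemma norm_sqNorm {t : 𝔽} (ht : IsPseudoUniformizer t) (τ : InfSYT lam) :
    ‖sqNorm t τ‖ = ‖t‖ ^ (invPairs τ).ncard := by
  rw [sqNorm, finprod_mem_eq_finite_toFinset_prod _ (invPairs_finite τ), norm_prod,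
    Set.ncard_eq_toFinset_card _ (invPairs_finite τ)]
  refine Finset.prod_eq_pow_card fun x hx => ?_
  -- A gap of at least two keeps the exponent `pairGap x - 1` positive; at gap one the factor would
  -- vanish.
  have := two_le_pairGap ((invPairs_finite τ).mem_toFinset.1 hx)
  rw [norm_div, norm_mul, norm_mul, norm_pow, ht.norm_eq_one (by omega),
    ht.norm_eq_one (by omega), ht.norm_eq_one (by omega)]
  simp

/-- The renormalizing scalar is a product of quotients of units, because all the exponents are
positive. The renormalization therefore does not disturb the estimates. -/
lemma norm_renormVec_le {t : 𝔽} (ht : IsPseudoUniformizer t) (τ : InfSYT lam) :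
    ‖renormVec t τ‖ ≤ 1 := by
  rw [renormVec, norm_smul]
  refine mul_le_one₀ ?_ (norm_nonneg _) (norm_basisVec_le τ)
  refine finprod_mem_induction (fun y : 𝔽 => ‖y‖ ≤ 1) norm_one.le ?_ ?_
  · intro x y hx hy
    rw [norm_mul]
    exact mul_le_one₀ hx (norm_nonneg _) hy
  · intro x hx
    have := two_le_pairGap hx
    rw [norm_div, ht.norm_eq_one (by omega), ht.norm_eq_one (by omega), div_one]

lemma mem_valRing_iff (x : 𝔽) : x ∈ valRing 𝔽 ↔ ‖x‖ ≤ 1 := by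
  rw [Valuation.mem_integer_iff]
  exact Iff.rfl

variable [CompleteSpace 𝔽]

/-- One estimate serves both claims: its second factor gives convergence, and with `‖A‖ ≤ 1` it
gives integrality term by term. -/
lemma norm_traceTerm_le {t : 𝔽} (ht : IsPseudoUniformizer t)
    (A : SpechtHat 𝔽 lam →L[𝔽] SpechtHat 𝔽 lam) (τ : InfSYT lam) :
    ‖traceTerm ht A τ‖ ≤ ‖A‖ * ‖t‖ ^ (invPairs τ).ncard := by
  have hA : ‖A (renormVec t τ) τ‖ ≤ ‖A‖ :=
    (norm_apply_le _ τ).trans (A.unit_le_opNorm _ (norm_renormVec_le ht τ))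
  have hc := (norm_apply_le (renormVec t τ : SpechtHat 𝔽 lam) τ).trans (norm_renormVec_le ht τ)
  -- `ẽ_τ` is supported at `τ` and the form is diagonal, so a single summand survives.
  have e : traceTerm ht A τ = A (renormVec t τ) τ * (renormVec t τ) τ * sqNorm t τ := by
    rw [traceTerm, innerForm_apply]
    refine tsum_eq_single τ fun x hx => ?_
    have : (renormVec t τ : SpechtHat 𝔽 lam) x = 0 := by
      rw [renormVec, ZeroAtInftyContinuousMap.smul_apply, basisVec_ne hx, smul_zero]
    rw [this, mul_zero, zero_mul]
  rw [e, norm_mul, norm_mul, norm_sqNorm ht]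
  exact mul_le_mul_of_nonneg_right
    ((mul_le_of_le_one_right (norm_nonneg _) hc).trans hA) (by positivity)

/-- The trace series of every bounded operator on `Ŝ_λ` converges unconditionally. -/
lemma summable_traceTerm {t : 𝔽} (ht : IsPseudoUniformizer t)
    (A : SpechtHat 𝔽 lam →L[𝔽] SpechtHat 𝔽 lam) :
    Summable fun τ : InfSYT lam => traceTerm ht A τ := by
  -- By completeness and the ultrametric inequality, decay along the cofinite filter suffices; no
  -- absolute summability is needed.
  refine NonarchimedeanAddGroup.summable_of_tendsto_cofinite_zero
    (squeeze_zero_norm (norm_traceTerm_le ht A) ?_)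
  have h := ((tendsto_pow_atTop_nhds_zero_of_lt_one (norm_nonneg t) ht.2).comp
    (tendsto_ncard_invPairs lam)).const_mul ‖A‖
  rwa [mul_zero] at h

lemma norm_extendBasis_le {S : Type*} [TopologicalSpace S] [DiscreteTopology S]
    (v : S → C₀(S, 𝔽)) {C : ℝ} (hC : 0 ≤ C) (hv : ∀ s, ‖v s‖ ≤ C) :
    ‖extendBasis v C hv‖ ≤ C :=
  -- The operator was built with the bound `max C 0`, which equals `C` here.
  (LinearMap.mkContinuous_norm_le _ (le_max_right _ _) _).trans (max_le le_rfl hC)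

/-- Each generator sends basis vectors into the unit ball, hence is a contraction, and contractions
compose. -/
lemma norm_heckeRep_word_le {t : 𝔽} (ht : IsPseudoUniformizer t) (lam : YoungDiagram)
    (w : List ℕ) : ‖heckeRep ht lam (w.map (heckeGen t)).prod‖ ≤ 1 := by
  induction w with
  | nil =>
    rw [List.map_nil, List.prod_nil, map_one]
    exact ContinuousLinearMap.norm_id_le
  | cons i w ih =>
    rw [List.map_cons, List.prod_cons, map_mul, heckeRep_gen]
    exact (ContinuousLinearMap.opNorm_comp_le _ _).trans
      (mul_le_one₀ (norm_extendBasis_le _ zero_le_one _) (norm_nonneg _) ih)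

/-- The `𝒪`-span of the standard basis acts on `Ŝ_λ` by operators of norm at most one. -/
lemma norm_heckeRep_le {t : 𝔽} (ht : IsPseudoUniformizer t) (lam : YoungDiagram)
    {X : HeckeAlgebra t} (hX : X ∈ integralHecke t) : ‖heckeRep ht lam X‖ ≤ 1 := by
  -- Stated vector by vector, closure under sums is just the ultrametric inequality in `c₀`.
  suffices h : ∀ f, ‖heckeRep ht lam X f‖ ≤ ‖f‖ from
    ContinuousLinearMap.opNorm_le_bound _ zero_le_one fun f => by rw [one_mul]; exact h f
  refine Submodule.span_induction ?_ ?_ ?_ ?_ hX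
  · rintro _ ⟨_, -, w, -, rfl⟩ f
    simpa using ContinuousLinearMap.le_of_opNorm_le _ (norm_heckeRep_word_le ht lam w) f
  · intro f
    rw [map_zero, zero_apply, norm_zero]
    exact norm_nonneg f
  · intro X Y _ _ hX hY f
    rw [map_add, add_apply]
    exact (IsUltrametricDist.norm_add_le_max _ _).trans (max_le (hX f) (hY f))
  · intro c X _ hX f
    -- The scalar is moved from `𝒪` to `𝔽`, over which the representation is linear.
    rw [← algebraMap_smul 𝔽 c X, map_smul, smul_apply, norm_smul]
    exact (mul_le_of_le_one_left (norm_nonneg _) ((mem_valRing_iff _).1 c.2)).trans (hX f)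

/-- The regularized trace is integral on the `𝒪`-span of the standard basis. -/
lemma regTrace_mem_valRing {t : 𝔽} (ht : IsPseudoUniformizer t) (lam : YoungDiagram)
    {X : HeckeAlgebra t} (hX : X ∈ integralHecke t) : regTrace ht lam X ∈ valRing 𝔽 := by
  have : Nonempty (InfSYT lam) := ⟨colStandard lam⟩
  rw [mem_valRing_iff]
  -- An ultrametric sum is no larger than a common bound for its terms; the index set is nonempty
  -- because it contains `τ_λ`.
  refine IsUltrametricDist.norm_tsum_le_of_forall_le fun τ => ?_
  exact (norm_traceTerm_le ht _ τ).trans (mul_le_one₀ (norm_heckeRep_le ht lam hX)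
    (by positivity) (pow_le_one₀ (norm_nonneg t) ht.2.le))

end Trace

end InfHecke

theorem mainTheorem5 {𝔽 : Type*} [NontriviallyNormedField 𝔽] [CompleteSpace 𝔽]
    [IsUltrametricDist 𝔽] {t : 𝔽} (ht : InfHecke.IsPseudoUniformizer t) (lam : YoungDiagram) :
    (∀ A : InfHecke.SpechtHat 𝔽 lam →L[𝔽] InfHecke.SpechtHat 𝔽 lam,
      Summable fun τ : InfHecke.InfSYT lam => InfHecke.traceTerm ht A τ) ∧
    ∀ X ∈ InfHecke.integralHecke t,
      InfHecke.regTrace ht lam X ∈ InfHecke.valRing 𝔽 :=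
  ⟨InfHecke.summable_traceTerm ht, fun _ hX => InfHecke.regTrace_mem_valRing ht lam hX⟩
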